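/- Let $m,n\ge 0$ be integers, let $E\subset\mathbb{C}$ be open with $0\in E$, and let $f:E\to\mathbb{C}$ be holomorphic. Let $K\subset\mathbb{C}$ be a non-empty compact set without isolated points, and write $\varepsilon K=\{\varepsilon z : z\in K\}$. For integers $\mu,\nu$ let $\mathcal{R}_{\mu\nu}$ be the set of rational functions $p/q$ with complex polynomials $p,q$, $\deg p\le \mu$, $\deg q\le \nu$, $q\not\equiv 0$ (a polynomial of degree at most a negative number is $0$). A function $r\in\mathcal{R}_{mn}$ is non-degenerate if $r\notin\mathcal{R}_{m-d,n-d}$ for all $d>0$. A function $r$ interpolates $f$ (in the Newton--Padé sense) at nodes $z_0,\dots,z_{m+n}\in E$, counted with multiplicity, if $r=p/q$ for polynomials $p,q$ with $\deg p\le m$, $\deg q\le n$, $q\not\equiv0$ and $p-qf=\tilde v\prod_{j=0}^{m+n}(z-z_j)$ on $E$ with $\tilde v$ holomorphic on $E$. The $(m,n)$-Padé approximant $r^P$ is the interpolant for the nodes $z_0=\dots=z_{m+n}=0$. For a set $S\subset\mathbb{C}$ let $\mathcal{I}_{mn}^{S}$ be the set of all $r\in\mathcal{R}_{mn}$ that interpolate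 $f$ in this sense at some $m+n+1$ nodes in $S\cap E$, counted with multiplicity. Let $\|r-f\|_{\varepsilon K}$ be the maximum of $|r-f|$ on $\varepsilon K$, with value $\infty$ if $r$ has a pole in $\varepsilon K$. The Chebyshev nodes $\tau_0,\dots,\tau_{m+n}$ of $K$ are the zeros, with multiplicity, of the polynomial $z^{m+n+1}-g(z)$ of least maximum norm on $K$, where $g$ ranges over the polynomials of degree at most $m+n$. Put $t_{m+n+1}=\max_{z\in K}\prod_{j=0}^{m+n}|z-\tau_j|$. Assume that $r^P$ is non-degenerate, and that the number $a_{mn}$ defined by $r^P(z)-f(z)=a_{mn}z^{m+n+1}+\mathcal{O}(z^{m+n+2})$ for $z\to0$ is not zero. Let $\Theta\subset\mathbb{C}$ be a compact set with $\tau_0,\dots,\tau_{m+n}\in\Theta$. For all sufficiently small $\varepsilon>0$ let $r^\varepsilon\in\mathcal{I}_{mn}^{\varepsilon\Theta}$ be an interpolatory best approximant on $\varepsilon K$, i.e. $\|r^\varepsilon-f\|_{\varepsilon K}=\min_{r\in\mathcal{I}_{mn}^{\varepsilon\Theta}}\|r-f\|_{\varepsilon K}$. Then, for $\varepsilon\to0^+$: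 (i) If $z_0(\varepsilon),\dots,z_{m+n}(\varepsilon)\in\varepsilon\Theta$ are interpolation nodes of $r^\varepsilon$, then, after reordering the nodes for each $\varepsilon$, $z_j(\varepsilon)/\varepsilon\to\tau_j$ for $j=0,\dots,m+n$. (ii) For $\varepsilon$ small enough $r^\varepsilon$ has no poles on $\varepsilon K$, and $r^\varepsilon(\varepsilon z)-f(\varepsilon z)=a_{mn}\varepsilon^{m+n+1}\prod_{j=0}^{m+n}(z-\tau_j)+o(\varepsilon^{m+n+1})$, uniformly for $z\in K$. (iii) $\|r^\varepsilon-f\|_{\varepsilon K}=t_{m+n+1}|a_{mn}|\varepsilon^{m+n+1}+\mathcal{O}(\varepsilon^{m+n+2})$. -/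

import Mathlib

open Filter Topology Asymptotics Polynomial
open scoped Pointwise ENNReal

noncomputable section

/-- A complex polynomial has degree at most the integer `k`. For `k < 0` only the zero polynomial
qualifies. -/
def PolyDegLE (p : ℂ[X]) (k : ℤ) : Prop :=
  ∀ i : ℕ, k < (i : ℤ) → p.coeff i = 0

/-- The set of rational functions `p / q` with polynomials `p`, `q` of degree at most `m`, `n`
and `q ≠ 0`. -/
def RationalMN (m n : ℤ) : Set (RatFunc ℂ) :=
  {r | ∃ p q : ℂ[X], PolyDegLE p m ∧ PolyDegLE q n ∧ q ≠ 0 ∧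
    r = algebraMap ℂ[X] (RatFunc ℂ) p / algebraMap ℂ[X] (RatFunc ℂ) q}

/-- An `(m, n)`-rational function is non-degenerate if its defect is zero, i.e. it does not
belong to `RationalMN (m - d) (n - d)` for any `d > 0`. Since a polynomial of negative degree
bound is zero, the zero function is non-degenerate only for `n = 0`. -/
def IsNondegenerate (m n : ℕ) (r : RatFunc ℂ) : Prop :=
  r ∈ RationalMN m n ∧ ∀ d : ℕ, 0 < d → r ∉ RationalMN ((m : ℤ) - d) ((n : ℤ) - d)

/-- The value of a rational function at `z`, computed from its reduced fraction. It is meaningful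
where the reduced denominator does not vanish. -/
def ratVal (r : RatFunc ℂ) (z : ℂ) : ℂ := RatFunc.eval (RingHom.id ℂ) z r

/-- `r` is the `(m, n)`-Newton--Padé approximant (the rational interpolant in the linearized
sense) to `f`, holomorphic on `E`, for the nodes `x 0, …, x (m + n) ∈ E`, counted with
multiplicity. -/
def IsNewtonPade (E : Set ℂ) (f : ℂ → ℂ) (m n : ℕ) (x : Fin (m + n + 1) → ℂ)
    (r : RatFunc ℂ) : Prop :=
  (∀ j, x j ∈ E) ∧
  ∃ p q : ℂ[X], PolyDegLE p m ∧ PolyDegLE q n ∧ q ≠ 0 ∧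
    r = algebraMap ℂ[X] (RatFunc ℂ) p / algebraMap ℂ[X] (RatFunc ℂ) q ∧
    ∃ v : ℂ → ℂ, DifferentiableOn ℂ v E ∧
      ∀ z ∈ E, p.eval z - q.eval z * f z = v z * ∏ j, (z - x j)

/-- The `(m, n)`-Padé approximant to `f`: all nodes are at the origin. -/
def IsPade (E : Set ℂ) (f : ℂ → ℂ) (m n : ℕ) (r : RatFunc ℂ) : Prop :=
  IsNewtonPade E f m n (fun _ => 0) r

/-- The set of `(m, n)`-rational functions that interpolate `f` in the Newton--Padé sense at
`m + n + 1` nodes in `Θ`, counted with multiplicity. -/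
def InterpolantSet (E : Set ℂ) (f : ℂ → ℂ) (m n : ℕ) (Θ : Set ℂ) : Set (RatFunc ℂ) :=
  {r | ∃ x : Fin (m + n + 1) → ℂ, (∀ j, x j ∈ Θ) ∧ IsNewtonPade E f m n x r}

open Classical in
/-- The uniform error `‖r - f‖` on `K`; it is `∞` if `r` has a pole in `K`. -/
def uniformError (K : Set ℂ) (f : ℂ → ℂ) (r : RatFunc ℂ) : ℝ≥0∞ :=
  ⨆ z ∈ K, if r.denom.eval z = 0 then ⊤ else ENNReal.ofReal ‖ratVal r z - f z‖

/-- `r` is an interpolatory best approximant to `f` on `K` with interpolation nodes in `Θ`. -/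
def IsInterpolatoryBest (E : Set ℂ) (f : ℂ → ℂ) (m n : ℕ) (Θ K : Set ℂ) (r : RatFunc ℂ) : Prop :=
  r ∈ InterpolantSet E f m n Θ ∧
    ∀ s ∈ InterpolantSet E f m n Θ, uniformError K f r ≤ uniformError K f s

/-- The maximum norm of a polynomial on a (nonempty, compact) set `K`. -/
def polyNormOn (K : Set ℂ) (p : ℂ[X]) : ℝ := sSup ((fun z => ‖p.eval z‖) '' K)

/-- `τ` lists, with multiplicity, the `N` Chebyshev nodes of `K`: the zeros of `X ^ N - g`, where
`g` minimizes the maximum norm of `X ^ N - g` on `K` among the polynomials of degree less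
than `N`. -/
def IsChebyshevNodes (K : Set ℂ) (N : ℕ) (τ : Fin N → ℂ) : Prop :=
  ∃ g : ℂ[X], PolyDegLE g ((N : ℤ) - 1) ∧
    (∀ h : ℂ[X], PolyDegLE h ((N : ℤ) - 1) → polyNormOn K (X ^ N - g) ≤ polyNormOn K (X ^ N - h)) ∧
    (X : ℂ[X]) ^ N - g = ∏ j, (X - C (τ j))

/-- The maximum of `∏ j, |z - τ j|` over `z ∈ K`; for the Chebyshev nodes `τ` this is the
Chebyshev constant of `K` of degree `N`. -/
def maxNodeProd (K : Set ℂ) {N : ℕ} (τ : Fin N → ℂ) : ℝ :=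
  sSup ((fun z => ∏ j, ‖z - τ j‖) '' K)

end

/-! ### Rational functions and degree bounds -/

/-! Write N = m + n + 1. Everything rests on one expansion, `exists_norm_error_sub_le`: an
interpolant with nodes εx_j, |x_j| ≤ R, has error aε^N ∏(z - x_j) + O(ε^(N+1)) at εz for |z| ≤ R,
uniformly in the nodes and in z. To leading order, a best approximant therefore minimizes the norm
on K of a monic node polynomial. Comparison with the interpolant at the nodes ετ_j
(`exists_isNewtonPade`) bounds the best error from above, and Chebyshev minimality bounds it from
below. The node polynomials are thus asymptotically minimal. As K is infinite, the minimal
polynomial is unique (`monic_eq_of_norm_le`), and compactness of Θ turns this into convergence of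
the nodes (`IsChebyshevNodes.exists_perm_tendsto`).

For the expansion, non-degeneracy makes the map from (p, q) to the first N derivatives of p - qf at
0 together with q(0) injective, hence bounded below on a finite-dimensional space. For nodes of
modulus at most δ these derivatives are O(δ), so after normalizing q(0) = 1 the coefficients lie
within O(δ) of the Padé ones. The maximum principle carries the estimate over to the quotient of p -
qf by the node product. -/

theorem eval_denom_ne_zero_and_ratVal_div (p q : ℂ[X]) {z : ℂ} (hz : q.eval z ≠ 0) :
    (algebraMap ℂ[X] (RatFunc ℂ) p / algebraMap ℂ[X] (RatFunc ℂ) q).denom.eval z ≠ 0 ∧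
    ratVal (algebraMap ℂ[X] (RatFunc ℂ) p / algebraMap ℂ[X] (RatFunc ℂ) q) z =
      p.eval z / q.eval z := by
  have hq : q ≠ 0 := by rintro rfl; simp at hz
  set x := algebraMap ℂ[X] (RatFunc ℂ) p / algebraMap ℂ[X] (RatFunc ℂ) q with hx
  have hd : x.denom.eval z ≠ 0 := by
    obtain ⟨s, hs⟩ := RatFunc.denom_div_dvd p q
    intro h
    rw [hs, eval_mul] at hz
    exact hz (by rw [h, zero_mul])
  refine ⟨hd, ?_⟩
  have h := congrArg (Polynomial.eval z) ((RatFunc.num_mul_eq_mul_denom_iff hq).2 hx)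
  rw [eval_mul, eval_mul] at h
  rw [ratVal, RatFunc.eval, Polynomial.eval₂_id, Polynomial.eval₂_id]
  exact (div_eq_div_iff hd hz).2 h

theorem polyDegLE_natCast_iff {p : ℂ[X]} {k : ℕ} :
    PolyDegLE p k ↔ p ∈ degreeLT ℂ (k + 1) := by
  rw [mem_degreeLT, degree_lt_iff_coeff_zero]
  simp only [PolyDegLE, Nat.cast_lt, Nat.succ_le_iff]

theorem polyDegLE_natCast_iff_natDegree_le {p : ℂ[X]} {k : ℕ} :
    PolyDegLE p k ↔ p.natDegree ≤ k := by
  rw [natDegree_le_iff_coeff_eq_zero]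
  simp only [PolyDegLE, Nat.cast_lt]

/-! ### Divided differences and the existence of Newton--Padé interpolants -/

/-- The space of functions that are holomorphic on `E`. -/
def holoSubmodule (E : Set ℂ) : Submodule ℂ (ℂ → ℂ) where
  carrier := {g | DifferentiableOn ℂ g E}
  add_mem' := DifferentiableOn.add
  zero_mem' := differentiableOn_const 0
  smul_mem' c _ h := DifferentiableOn.const_smul h c

/-- `g ↦ dslope g b` as a linear endomorphism of the space of holomorphic functions on `E`. -/
noncomputable def holoDslope (E : Set ℂ) (hE : IsOpen E) (b : ℂ) (hb : b ∈ E) :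
    holoSubmodule E →ₗ[ℂ] holoSubmodule E where
  toFun g := ⟨dslope g b, (Complex.differentiableOn_dslope (hE.mem_nhds hb)).2 g.2⟩
  map_add' g h := by
    ext z
    rcases eq_or_ne z b with rfl | hz
    · simpa using deriv_add (g.2.differentiableAt (hE.mem_nhds hb))
        (h.2.differentiableAt (hE.mem_nhds hb))
    · simp [dslope_of_ne _ hz, slope_def_field]
      ring
  map_smul' c g := by
    ext z
    rcases eq_or_ne z b with rfl | hz
    · simpa using deriv_const_smul c (g.2.differentiableAt (hE.mem_nhds hb))
    · simp [dslope_of_ne _ hz, slope_def_field]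
      ring

/-- The coordinates are Newton's divided differences: evaluate at the first node, pass to the slope
there, recurse. Their linearity turns interpolation, multiple nodes included, into N homogeneous
linear equations. -/
theorem exists_linearMap_of_nodes {E : Set ℂ} (hE : IsOpen E) :
    ∀ {N : ℕ} (x : Fin N → ℂ), (∀ j, x j ∈ E) →
      ∃ L : holoSubmodule E →ₗ[ℂ] (Fin N → ℂ), ∀ g : holoSubmodule E, L g = 0 →
        ∃ v : ℂ → ℂ, DifferentiableOn ℂ v E ∧ ∀ z ∈ E, (g : ℂ → ℂ) z = v z * ∏ j, (z - x j)
  | 0, _, _ => ⟨0, fun g _ => ⟨g, g.2, by simp⟩⟩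
  | N + 1, x, hx => by
    obtain ⟨L, hL⟩ := exists_linearMap_of_nodes hE (fun j : Fin N => x j.succ) fun j => hx _
    let ev : holoSubmodule E →ₗ[ℂ] ℂ := (LinearMap.proj (x 0)).comp (holoSubmodule E).subtype
    refine ⟨LinearMap.pi (Fin.cons ev fun i =>
      (LinearMap.proj i).comp (L.comp (holoDslope E hE (x 0) (hx 0)))), fun g hg => ?_⟩
    have h0 : (g : ℂ → ℂ) (x 0) = 0 := by simpa [ev] using congrFun hg 0
    have h1 : L (holoDslope E hE (x 0) (hx 0) g) = 0 := by
      ext i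
      simpa using congrFun hg i.succ
    obtain ⟨v, hv, hgv⟩ := hL _ h1
    refine ⟨v, hv, fun z hz => ?_⟩
    have h2 : dslope g (x 0) z = v z * ∏ j : Fin N, (z - x j.succ) := hgv z hz
    have h3 := sub_smul_dslope (g : ℂ → ℂ) (x 0) z
    rw [h0, sub_zero, h2, smul_eq_mul] at h3
    rw [← h3, Fin.prod_univ_succ]
    ring

theorem eq_zero_of_eval_eq_mul_prod {E : Set ℂ} (hE : IsOpen E) {v : ℂ → ℂ}
    (hv : ContinuousOn v E) :
    ∀ {N : ℕ} (x : Fin N → ℂ), (∀ j, x j ∈ E) → ∀ p : ℂ[X], p.degree < N →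
      (∀ z ∈ E, p.eval z = v z * ∏ j, (z - x j)) → p = 0
  | 0, _, _, p, hp, _ => by
    have : p.degree < 0 := by simpa using hp
    exact degree_lt_iff_coeff_zero p 0 |>.1 (by simpa using hp) |> fun h => by ext i; simp [h i]
  | N + 1, x, hx, p, hp, h => by
    have h0 : p.IsRoot (x 0) := by
      rw [IsRoot, h _ (hx 0), Fin.prod_univ_succ]
      simp
    obtain ⟨p', rfl⟩ := dvd_iff_isRoot.2 h0
    have key : ∀ z ∈ E, z ≠ x 0 → p'.eval z = v z * ∏ j : Fin N, (z - x j.succ) := by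
      intro z hz hne
      have h1 := h z hz
      rw [Fin.prod_univ_succ, eval_mul, eval_sub, eval_X, eval_C] at h1
      apply mul_left_cancel₀ (sub_ne_zero.2 hne)
      rw [h1]; ring
    have hp' : p' = 0 := by
      refine eq_zero_of_eval_eq_mul_prod hE hv (fun j : Fin N => x j.succ) (fun j => hx _) p' ?_ ?_
      · rw [degree_mul, degree_X_sub_C, add_comm, Nat.cast_add, Nat.cast_one] at hp
        exact lt_of_add_lt_add_right hp
      · intro z hz
        -- The factor z - x 0 cannot be cancelled at the node itself; there the identity follows by
        -- continuity of `v`.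
        rcases eq_or_ne z (x 0) with rfl | hne
        · have hE0 := hE.mem_nhds hz
          have c1 : Tendsto (fun w => p'.eval w) (𝓝[≠] x 0) (𝓝 (p'.eval (x 0))) :=
            p'.continuous.continuousAt.tendsto.mono_left nhdsWithin_le_nhds
          have c2 : Tendsto (fun w => v w * ∏ j : Fin N, (w - x j.succ)) (𝓝[≠] x 0)
              (𝓝 (v (x 0) * ∏ j : Fin N, (x 0 - x j.succ))) := by
            refine Tendsto.mono_left (ContinuousAt.tendsto ?_) nhdsWithin_le_nhds
            exact (hv.continuousAt hE0).mul (Continuous.continuousAt (by fun_prop))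
          refine tendsto_nhds_unique_of_eventuallyEq c1 c2 ?_
          filter_upwards [nhdsWithin_le_nhds hE0, self_mem_nhdsWithin] with w hw hne
          exact key w hw hne
        · exact key z hz hne
    rw [hp', mul_zero]

/-- There are m + n + 2 coefficients and only m + n + 1 linear conditions. A nonzero solution has q
≠ 0, since otherwise p would have more zeros than its degree allows. -/
theorem exists_isNewtonPade {E : Set ℂ} (hE : IsOpen E) {f : ℂ → ℂ}
    (hf : DifferentiableOn ℂ f E) (m n : ℕ) (x : Fin (m + n + 1) → ℂ) (hx : ∀ j, x j ∈ E) :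
    ∃ r, IsNewtonPade E f m n x r := by
  obtain ⟨L, hL⟩ := exists_linearMap_of_nodes hE x hx
  let Φ : (degreeLT ℂ (m + 1) × degreeLT ℂ (n + 1)) →ₗ[ℂ] holoSubmodule E :=
    { toFun := fun c => ⟨fun z => (c.1 : ℂ[X]).eval z - (c.2 : ℂ[X]).eval z * f z,
        (Polynomial.differentiable _).differentiableOn.sub
          ((Polynomial.differentiable _).differentiableOn.mul hf)⟩
      map_add' := fun c d => by ext z; simp; ring
      map_smul' := fun c d => by ext z; simp; ring }
  have hdim : Module.finrank ℂ (Fin (m + n + 1) → ℂ) <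
      Module.finrank ℂ (degreeLT ℂ (m + 1) × degreeLT ℂ (n + 1)) := by
    rw [Module.finrank_prod, (degreeLTEquiv ℂ (m + 1)).finrank_eq,
      (degreeLTEquiv ℂ (n + 1)).finrank_eq]
    simp
    omega
  have : FiniteDimensional ℂ (degreeLT ℂ (m + 1)) :=
    (degreeLTEquiv ℂ (m + 1)).symm.finiteDimensional
  have : FiniteDimensional ℂ (degreeLT ℂ (n + 1)) :=
    (degreeLTEquiv ℂ (n + 1)).symm.finiteDimensional
  obtain ⟨⟨p, q⟩, hpq, hne⟩ := Submodule.exists_mem_ne_zero_of_ne_bot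
    (LinearMap.ker_ne_bot_of_finrank_lt (f := L.comp Φ) hdim)
  obtain ⟨v, hv, h⟩ := hL (Φ (p, q)) hpq
  have h' : ∀ z ∈ E, (p : ℂ[X]).eval z - (q : ℂ[X]).eval z * f z = v z * ∏ j, (z - x j) := h
  refine ⟨_, hx, p, q, polyDegLE_natCast_iff.2 p.2, polyDegLE_natCast_iff.2 q.2, ?_, rfl,
    v, hv, h'⟩
  intro hq
  apply hne
  have hp : (p : ℂ[X]) = 0 := by
    refine eq_zero_of_eval_eq_mul_prod hE hv.continuousOn x hx p ?_ ?_
    · exact (mem_degreeLT.1 p.2).trans_le (by exact_mod_cast (by omega : m + 1 ≤ m + n + 1))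
    · intro z hz
      rw [← h' z hz, hq]; simp
  exact Prod.ext (Subtype.ext hp) (Subtype.ext hq)

/-! ### Uniqueness of the Padé numerator and denominator -/

/-- A germ at the origin that vanishes to order at least `N`. -/
def VanishesToOrder (g : ℂ → ℂ) (N : ℕ) : Prop :=
  ∃ h : ℂ → ℂ, AnalyticAt ℂ h 0 ∧ ∀ᶠ z in 𝓝 0, g z = z ^ N * h z

theorem eq_zero_of_vanishesToOrder {p : ℂ[X]} {N : ℕ} (hp : p.degree < N)
    (h : VanishesToOrder (fun z => p.eval z) N) : p = 0 := by
  obtain ⟨v, hv, h⟩ := h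
  obtain ⟨U, hU, hUo, h0⟩ := eventually_nhds_iff.1 (hv.eventually_analyticAt.and h)
  refine eq_zero_of_eval_eq_mul_prod hUo (v := v)
    (fun z hz => (hU z hz).1.continuousAt.continuousWithinAt) (fun _ : Fin N => 0)
    (fun _ => h0) p hp fun z hz => ?_
  rw [show p.eval z = z ^ N * v z from (hU z hz).2]
  simp [mul_comm]

/-- The polynomial pQ - qP has degree at most m + n and vanishes to order m + n + 1, so p/q = P/Q
unless q = 0. By non-degeneracy, p and q are then the reduced pair up to a constant, and q(0) = 0
would force a common zero at 0. -/
theorem numerator_denominator_eq_zero_of_eval_zero {f : ℂ → ℂ} {m n : ℕ} {P Q p q : ℂ[X]}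
    (hnd : IsNondegenerate m n (algebraMap ℂ[X] (RatFunc ℂ) P / algebraMap ℂ[X] (RatFunc ℂ) Q))
    (hP : PolyDegLE P m) (hQ : PolyDegLE Q n) (hQ0 : Q ≠ 0)
    (hPQ : VanishesToOrder (fun z => P.eval z - Q.eval z * f z) (m + n + 1))
    (hp : PolyDegLE p m) (hq : PolyDegLE q n)
    (hpq : VanishesToOrder (fun z => p.eval z - q.eval z * f z) (m + n + 1))
    (h0 : q.eval 0 = 0) : p = 0 ∧ q = 0 := by
  rw [polyDegLE_natCast_iff_natDegree_le] at hP hQ hp hq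
  have hcross : p * Q = q * P := by
    rw [← sub_eq_zero]
    apply eq_zero_of_vanishesToOrder (N := m + n + 1)
    · refine degree_le_natDegree.trans_lt ?_
      have h1 : (p * Q).natDegree ≤ m + n := natDegree_mul_le.trans (by omega)
      have h2 : (q * P).natDegree ≤ m + n := natDegree_mul_le.trans (by omega)
      have h3 := natDegree_sub_le_of_le h1 h2
      exact_mod_cast Nat.lt_succ_of_le (by simpa using h3)
    · obtain ⟨u, hu, hu'⟩ := hPQ
      obtain ⟨v, hv, hv'⟩ := hpq
      refine ⟨fun z => v z * Q.eval z - q.eval z * u z,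
        (hv.mul (Q.differentiable.analyticAt 0)).sub ((q.differentiable.analyticAt 0).mul hu), ?_⟩
      filter_upwards [hu', hv'] with z hz hz'
      simp only [eval_sub, eval_mul]
      linear_combination Q.eval z * hz' - q.eval z * hz
  by_cases hq0 : q = 0
  · refine ⟨?_, hq0⟩
    rw [hq0, zero_mul] at hcross
    exact (mul_eq_zero.1 hcross).resolve_right hQ0
  exfalso
  set r := algebraMap ℂ[X] (RatFunc ℂ) P / algebraMap ℂ[X] (RatFunc ℂ) Q with hr
  have hrpq : r = algebraMap ℂ[X] (RatFunc ℂ) p / algebraMap ℂ[X] (RatFunc ℂ) q := by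
    rw [hr, div_eq_div_iff (by simpa using hQ0) (by simpa using hq0), ← map_mul, ← map_mul,
      hcross, mul_comm]
  have hnum := (RatFunc.num_mul_eq_mul_denom_iff hq0).2 hrpq
  obtain ⟨s, hs⟩ : r.denom ∣ q := hrpq ▸ RatFunc.denom_div_dvd p q
  have hs0 : s ≠ 0 := by rintro rfl; simp [hq0] at hs
  have hps : p = r.num * s := by
    apply mul_right_cancel₀ r.denom_ne_zero
    rw [← hnum, hs]; ring
  have hsdeg : s.natDegree = 0 := by
    -- A common factor of positive degree would leave room to lower both degree bounds of the
    -- reduced fraction.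
    by_contra hne
    refine hnd.2 s.natDegree (Nat.pos_of_ne_zero hne) ⟨r.num, r.denom, ?_, ?_, r.denom_ne_zero,
      (RatFunc.num_div_denom r).symm⟩
    · intro i hi
      by_contra hc
      have hn0 : r.num ≠ 0 := by intro h; simp [h] at hc
      have := le_natDegree_of_ne_zero hc
      rw [hps, natDegree_mul hn0 hs0] at hp
      omega
    · intro i hi
      by_contra hc
      have := le_natDegree_of_ne_zero hc
      rw [hs, natDegree_mul r.denom_ne_zero hs0] at hq
      omega
  rw [natDegree_eq_zero] at hsdeg
  obtain ⟨c, rfl⟩ := hsdeg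
  have hc : c ≠ 0 := by rintro rfl; simp at hs0
  have hd0 : r.denom.eval 0 = 0 := by
    rw [hs, eval_mul, eval_C] at h0
    exact (mul_eq_zero.1 h0).resolve_right hc
  have hn0 : r.num.eval 0 = 0 := by
    obtain ⟨v, hv, hv'⟩ := hpq
    have := hv'.self_of_nhds
    simpa [h0, hps, hc] using this
  obtain ⟨α, β, hαβ⟩ := r.isCoprime_num_denom
  simpa [hd0, hn0] using congrArg (Polynomial.eval 0) hαβ

/-! ### Quantitative stability of the linearized interpolation problem -/

theorem norm_prod_sub_sub_pow_le {δ : ℝ} (hδ : δ ≤ 1) {z : ℂ} (hz : ‖z‖ ≤ 1) :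
    ∀ {N : ℕ} (w : Fin N → ℂ), (∀ j, ‖w j‖ ≤ δ) → ‖∏ j, (z - w j) - z ^ N‖ ≤ N * 2 ^ N * δ
  | 0, _, _ => by simp
  | N + 1, w, hw => by
    have hδ0 : 0 ≤ δ := (norm_nonneg _).trans (hw 0)
    have ih := norm_prod_sub_sub_pow_le hδ hz (fun j : Fin N => w j.succ) fun j => hw _
    have h1 : ‖z - w 0‖ ≤ 2 := (norm_sub_le _ _).trans (by linarith [hw 0])
    have h2 : ‖z ^ N‖ ≤ 2 ^ N := by
      rw [norm_pow]
      exact pow_le_pow_left₀ (norm_nonneg _) (hz.trans one_le_two) N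
    have hid : ∏ j, (z - w j) - z ^ (N + 1) =
        (z - w 0) * (∏ j : Fin N, (z - w j.succ) - z ^ N) - w 0 * z ^ N := by
      rw [Fin.prod_univ_succ]; ring
    rw [hid]
    calc _ ≤ ‖z - w 0‖ * ‖∏ j : Fin N, (z - w j.succ) - z ^ N‖ + ‖w 0‖ * ‖z ^ N‖ := by
          rw [← norm_mul, ← norm_mul]; exact norm_sub_le _ _
      _ ≤ 2 * (N * 2 ^ N * δ) + δ * 2 ^ N := by
          gcongr
          exact hw 0
      _ ≤ 2 * (N * 2 ^ N * δ) + 2 * (δ * 2 ^ N) := by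
          have : 0 ≤ δ * 2 ^ N := by positivity
          linarith
      _ = _ := by push_cast; ring

theorem norm_le_on_closedBall {E : Set ℂ} {g : ℂ → ℂ} (hg : DifferentiableOn ℂ g E) {ρ M : ℝ}
    (hρ : 0 < ρ) (hρE : Metric.closedBall 0 ρ ⊆ E) (hM : ∀ z, ‖z‖ = ρ → ‖g z‖ ≤ M) {z : ℂ}
    (hz : ‖z‖ ≤ ρ) : ‖g z‖ ≤ M := by
  refine Complex.norm_le_of_forall_mem_frontier_norm_le Metric.isBounded_ball
    (hg.diffContOnCl_ball hρE) (fun w hw => hM w ?_) (z := z) ?_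
  · rw [frontier_ball _ hρ.ne'] at hw
    simpa using hw
  · rw [closure_ball _ hρ.ne']
    simpa using hz

/-- On the circle of radius ρ every factor has modulus at least ρ/2; the maximum principle extends
the resulting bound to the disc. -/
theorem norm_le_of_norm_mul_prod_le {E : Set ℂ} {v : ℂ → ℂ} (hv : DifferentiableOn ℂ v E) {ρ M δ : ℝ}
    (hρ : 0 < ρ) (hρE : Metric.closedBall 0 ρ ⊆ E) {N : ℕ} {w : Fin N → ℂ}
    (hw : ∀ j, ‖w j‖ ≤ δ) (hδ : δ ≤ ρ / 2)
    (hM : ∀ z, ‖z‖ = ρ → ‖v z * ∏ j, (z - w j)‖ ≤ M) {z : ℂ} (hz : ‖z‖ ≤ ρ) :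
    ‖v z‖ ≤ M * (2 / ρ) ^ N := by
  refine norm_le_on_closedBall hv hρ hρE (fun z hz => ?_) hz
  have h1 : (ρ / 2) ^ N ≤ ‖∏ j, (z - w j)‖ := by
    rw [norm_prod]
    calc (ρ / 2) ^ N = ∏ _j : Fin N, (ρ / 2) := by rw [Finset.prod_const, Finset.card_fin]
      _ ≤ _ := Finset.prod_le_prod (fun _ _ => by positivity) fun j _ => by
        have := norm_sub_norm_le z (w j)
        linarith [hw j]
  have h2 := hM z hz
  rw [norm_mul] at h2
  have h3 : ‖v z‖ * (ρ / 2) ^ N ≤ M :=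
    (mul_le_mul_of_nonneg_left h1 (norm_nonneg _)).trans h2
  have h4 : M * (2 / ρ) ^ N = M / (ρ / 2) ^ N := by
    rw [div_eq_mul_inv M, ← inv_pow, inv_div]
  rwa [h4, le_div_iff₀ (by positivity)]

theorem iteratedDeriv_mul_pow_eq_zero {v : ℂ → ℂ} (hv : AnalyticAt ℂ v 0) {N k : ℕ} (hk : k < N) :
    iteratedDeriv k (fun z => v z * z ^ N) 0 = 0 := by
  have han : AnalyticAt ℂ (fun z => v z * z ^ N) 0 := by fun_prop
  refine (natCast_le_analyticOrderAt_iff_iteratedDeriv_eq_zero han (n := N)).1 ?_ k hk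
  exact (natCast_le_analyticOrderAt han).2 ⟨v, hv, .of_forall fun z => by simp [mul_comm]⟩

/-- Replacing the node product by z^N costs O(δ) on the circle, and v z^N contributes nothing to
derivatives of order below N; Cauchy's estimate does the rest. -/
theorem norm_iteratedDeriv_mul_prod_le {E : Set ℂ} (hE : IsOpen E) {v : ℂ → ℂ}
    (hv : DifferentiableOn ℂ v E) {ρ M δ : ℝ}
    (hρ : 0 < ρ) (hρ1 : ρ ≤ 1) (hρE : Metric.closedBall 0 ρ ⊆ E) {N : ℕ} {w : Fin N → ℂ}
    (hw : ∀ j, ‖w j‖ ≤ δ) (hδ0 : 0 ≤ δ) (hδ : δ ≤ ρ / 2) (hM0 : 0 ≤ M)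
    (hM : ∀ z, ‖z‖ = ρ → ‖v z * ∏ j, (z - w j)‖ ≤ M) {k : ℕ} (hk : k < N) :
    ‖iteratedDeriv k (fun z => v z * ∏ j, (z - w j)) 0‖ ≤
      N.factorial * (2 / ρ) ^ N * (N * 2 ^ N) / ρ ^ N * δ * M := by
  have h0E : (0 : ℂ) ∈ E := hρE (by simp [hρ.le])
  have hva : AnalyticAt ℂ v 0 := hv.analyticAt (hE.mem_nhds h0E)
  set e : ℂ → ℂ := fun z => v z * (∏ j, (z - w j) - z ^ N) with he
  have hsplit : (fun z => v z * ∏ j, (z - w j)) = fun z => e z + v z * z ^ N := by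
    ext z; simp only [he]; ring
  have hed : DifferentiableOn ℂ e E := hv.mul (by fun_prop)
  have hea : AnalyticAt ℂ e 0 := hed.analyticAt (hE.mem_nhds h0E)
  have hza : AnalyticAt ℂ (fun z => v z * z ^ N) 0 := by fun_prop
  rw [hsplit, iteratedDeriv_fun_add hea.contDiffAt hza.contDiffAt,
    iteratedDeriv_mul_pow_eq_zero hva hk, add_zero]
  have hb : ∀ z ∈ Metric.sphere (0 : ℂ) ρ, ‖e z‖ ≤ M * (2 / ρ) ^ N * (N * 2 ^ N * δ) := by
    intro z hz
    have hz' : ‖z‖ = ρ := by simpa using hz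
    rw [he, norm_mul]
    gcongr
    · exact norm_le_of_norm_mul_prod_le hv hρ hρE hw hδ hM hz'.le
    · exact norm_prod_sub_sub_pow_le (by linarith) (by linarith) w hw
  refine (Complex.norm_iteratedDeriv_le_of_forall_mem_sphere_norm_le k hρ
    (hed.diffContOnCl_ball hρE) hb).trans ?_
  have h1 : (k.factorial : ℝ) ≤ N.factorial := by exact_mod_cast Nat.factorial_le hk.le
  have h2 : ρ ^ N ≤ ρ ^ k := pow_le_pow_of_le_one hρ.le hρ1 hk.le
  calc k.factorial * (M * (2 / ρ) ^ N * (N * 2 ^ N * δ)) / ρ ^ k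
      ≤ N.factorial * (M * (2 / ρ) ^ N * (N * 2 ^ N * δ)) / ρ ^ N := by gcongr
    _ = _ := by ring

/-! ### Coefficient vectors and the linearized residual -/

open Classical in
theorem norm_eval_ofFn_le {k : ℕ} (c : Fin k → ℂ) {z : ℂ} (hz : ‖z‖ ≤ 1) :
    ‖(ofFn k c).eval z‖ ≤ k * ‖c‖ := by
  rw [ofFn_eq_sum_monomial, eval_finsetSum]
  calc _ ≤ ∑ i : Fin k, ‖(monomial (i : ℕ) (c i)).eval z‖ := norm_sum_le _ _
    _ ≤ ∑ _i : Fin k, ‖c‖ := Finset.sum_le_sum fun i _ => by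
      rw [eval_monomial, norm_mul, norm_pow]
      calc _ ≤ ‖c‖ * 1 := by
            gcongr
            · exact norm_le_pi_norm c i
            · exact pow_le_one₀ (norm_nonneg _) hz
        _ = _ := mul_one _
    _ = _ := by simp

theorem polyDegLE_ofFn [DecidableEq ℂ] {k : ℕ} (c : Fin (k + 1) → ℂ) :
    PolyDegLE (ofFn (k + 1) c) k :=
  polyDegLE_natCast_iff.2 (mem_degreeLT.2 (ofFn_degree_lt c))

theorem ofFn_toFn_of_polyDegLE [DecidableEq ℂ] {k : ℕ} {p : ℂ[X]} (hp : PolyDegLE p k) :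
    ofFn (k + 1) (toFn (k + 1) p) = p :=
  ofFn_comp_toFn_eq_id_of_natDegree_lt
    (Nat.lt_succ_of_le (polyDegLE_natCast_iff_natDegree_le.1 hp))

/-- Coefficient vectors of a numerator of degree at most `m` and a denominator of degree at
most `n`. -/
abbrev CoeffPair (m n : ℕ) := (Fin (m + 1) → ℂ) × (Fin (n + 1) → ℂ)

open Classical in
/-- The linearized residual `p - q f` as a function of the coefficients of `p` and `q`. -/
noncomputable def padeResidual (f : ℂ → ℂ) {m n : ℕ} (c : CoeffPair m n) (z : ℂ) : ℂ :=
  (ofFn (m + 1) c.1).eval z - (ofFn (n + 1) c.2).eval z * f z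

theorem padeResidual_add (f : ℂ → ℂ) {m n : ℕ} (c d : CoeffPair m n) :
    padeResidual f (c + d) = fun z => padeResidual f c z + padeResidual f d z := by
  ext z; simp [padeResidual]; ring

theorem padeResidual_sub (f : ℂ → ℂ) {m n : ℕ} (c d : CoeffPair m n) :
    padeResidual f (c - d) = fun z => padeResidual f c z - padeResidual f d z := by
  ext z; simp [padeResidual]; ring

theorem padeResidual_smul (f : ℂ → ℂ) {m n : ℕ} (t : ℂ) (c : CoeffPair m n) :
    padeResidual f (t • c) = fun z => t * padeResidual f c z := by
  ext z; simp [padeResidual]; ring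

theorem analyticAt_padeResidual {f : ℂ → ℂ} {z : ℂ} (hf : AnalyticAt ℂ f z) {m n : ℕ}
    (c : CoeffPair m n) : AnalyticAt ℂ (padeResidual f c) z :=
  ((Polynomial.differentiable _).analyticAt z).sub
    (((Polynomial.differentiable _).analyticAt z).mul hf)

theorem norm_padeResidual_le {f : ℂ → ℂ} {m n : ℕ} (c : CoeffPair m n) {z : ℂ} {F : ℝ}
    (hz : ‖z‖ ≤ 1) (hF : ‖f z‖ ≤ F) :
    ‖padeResidual f c z‖ ≤ ((m + 1 : ℕ) + (n + 1 : ℕ) * F) * ‖c‖ := by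
  classical
  have h1 := norm_eval_ofFn_le c.1 hz
  have h2 := norm_eval_ofFn_le c.2 hz
  calc _ ≤ _ + _ := norm_sub_le _ _
    _ ≤ (m + 1 : ℕ) * ‖c‖ + ((n + 1 : ℕ) * ‖c‖) * F := by
      rw [norm_mul]
      gcongr
      · exact h1.trans (by gcongr; exact norm_fst_le c)
      · exact h2.trans (by gcongr; exact norm_snd_le c)
    _ = _ := by ring

open Classical in
-- An injective linear map on a finite-dimensional space is bounded below.
theorem exists_norm_coeffPair_le {f : ℂ → ℂ} (hf : AnalyticAt ℂ f 0) {m n : ℕ} (N : ℕ)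
    (hinj : ∀ p q : ℂ[X], PolyDegLE p m → PolyDegLE q n →
      VanishesToOrder (fun z => p.eval z - q.eval z * f z) N → q.eval 0 = 0 → p = 0 ∧ q = 0) :
    ∃ C : ℝ, 0 < C ∧ ∀ (c : CoeffPair m n) (M : ℝ), 0 ≤ M →
      (∀ k < N, ‖iteratedDeriv k (padeResidual f c) 0‖ ≤ M) →
      ‖(ofFn (n + 1) c.2).eval 0‖ ≤ M → ‖c‖ ≤ C * M := by
  let T : CoeffPair m n →ₗ[ℂ] (Fin N → ℂ) × ℂ :=
    { toFun := fun c => (fun k => iteratedDeriv k (padeResidual f c) 0, (ofFn (n + 1) c.2).eval 0)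
      map_add' := fun c d => by
        refine Prod.ext (funext fun k => ?_) (by simp)
        simp only [padeResidual_add]
        exact iteratedDeriv_fun_add (analyticAt_padeResidual hf c).contDiffAt (analyticAt_padeResidual hf d).contDiffAt
      map_smul' := fun t c => by
        refine Prod.ext (funext fun k => ?_) (by simp)
        simp only [padeResidual_smul]
        exact iteratedDeriv_const_mul t (analyticAt_padeResidual hf c).contDiffAt }
  have hT : LinearMap.ker T = ⊥ := by
    rw [LinearMap.ker_eq_bot']
    intro c hc
    have h1 : ∀ k < N, iteratedDeriv k (padeResidual f c) 0 = 0 := fun k hk =>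
      congrFun (congrArg Prod.fst hc) ⟨k, hk⟩
    have h2 : (ofFn (n + 1) c.2).eval 0 = 0 := congrArg Prod.snd hc
    obtain ⟨h, hh, hh'⟩ := (natCast_le_analyticOrderAt (analyticAt_padeResidual hf c)).1
      ((natCast_le_analyticOrderAt_iff_iteratedDeriv_eq_zero (analyticAt_padeResidual hf c) (n := N)).2 h1)
    obtain ⟨hp, hq⟩ := hinj _ _ (polyDegLE_ofFn c.1) (polyDegLE_ofFn c.2)
      ⟨h, hh, by simpa [padeResidual] using hh'⟩ h2
    exact Prod.ext (injective_ofFn _ (by simpa using hp)) (injective_ofFn _ (by simpa using hq))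
  obtain ⟨C, hC, hanti⟩ := T.exists_antilipschitzWith hT
  refine ⟨C, hC, fun c M hM h1 h2 => ?_⟩
  have h3 := hanti.le_mul_norm_sub 0 c
  simp only [map_zero, neg_zero, zero_add] at h3
  refine h3.trans ?_
  gcongr
  rw [norm_prod_le_iff]
  exact ⟨(pi_norm_le_iff_of_nonneg hM).2 fun k => h1 k k.2, h2⟩

theorem exists_closedBall_subset_norm_le {E : Set ℂ} (hE : IsOpen E) (h0E : (0 : ℂ) ∈ E)
    {f : ℂ → ℂ} (hf : DifferentiableOn ℂ f E) :
    ∃ ρ > 0, ρ ≤ 1 ∧ Metric.closedBall 0 ρ ⊆ E ∧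
      ∃ F : ℝ, 0 ≤ F ∧ ∀ z : ℂ, ‖z‖ ≤ ρ → ‖f z‖ ≤ F := by
  obtain ⟨ρ, hρ, hρE⟩ := Metric.nhds_basis_closedBall.mem_iff.1 (hE.mem_nhds h0E)
  have hsub : Metric.closedBall (0 : ℂ) (min ρ 1) ⊆ E :=
    (Metric.closedBall_subset_closedBall (min_le_left _ _)).trans hρE
  obtain ⟨F, hF⟩ := (isCompact_closedBall (0 : ℂ) (min ρ 1)).exists_bound_of_continuousOn
    (hf.continuousOn.mono hsub)
  exact ⟨min ρ 1, lt_min hρ one_pos, min_le_right _ _, hsub, max F 0, le_max_right _ _,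
    fun z hz => (hF z (by simpa using hz)).trans (le_max_left _ _)⟩

theorem exists_norm_sub_le_mul {g : ℂ → ℂ} (hg : DifferentiableAt ℂ g 0) :
    ∃ δ₀ > 0, ∃ C : ℝ, 0 ≤ C ∧ ∀ z : ℂ, ‖z‖ ≤ δ₀ → ‖g z - g 0‖ ≤ C * ‖z‖ := by
  obtain ⟨C, hC, h⟩ := hg.isBigO_sub.exists_nonneg
  obtain ⟨δ₀, hδ₀, hb⟩ := Metric.nhds_basis_closedBall.mem_iff.1 h.bound
  refine ⟨δ₀, hδ₀, C, hC, fun z hz => ?_⟩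
  have := hb (show z ∈ Metric.closedBall 0 δ₀ by simpa using hz)
  simpa using this

open Classical in
/-- Coefficients of linearized interpolants with nodes of modulus at most `δ` are controlled by the
value of the denominator at the origin. -/
theorem exists_norm_coeff_le_of_nodes {E : Set ℂ} (hE : IsOpen E) {f : ℂ → ℂ}
    (hf : DifferentiableOn ℂ f E) {m n N : ℕ} {ρ F : ℝ} (hρ : 0 < ρ) (hρ1 : ρ ≤ 1)
    (hρE : Metric.closedBall 0 ρ ⊆ E) (hF0 : 0 ≤ F) (hF : ∀ z : ℂ, ‖z‖ ≤ ρ → ‖f z‖ ≤ F)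
    (hinj : ∀ p q : ℂ[X], PolyDegLE p m → PolyDegLE q n →
      VanishesToOrder (fun z => p.eval z - q.eval z * f z) N → q.eval 0 = 0 → p = 0 ∧ q = 0) :
    ∃ δ₀ > 0, ∃ C : ℝ, 0 < C ∧ ∃ D : ℝ, 0 ≤ D ∧ ∀ δ, 0 ≤ δ → δ ≤ δ₀ →
      ∀ (c : CoeffPair m n) (v : ℂ → ℂ) (w : Fin N → ℂ), DifferentiableOn ℂ v E →
      (∀ z ∈ E, padeResidual f c z = v z * ∏ j, (z - w j)) → (∀ j, ‖w j‖ ≤ δ) →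
      ‖c‖ ≤ C * ‖(ofFn (n + 1) c.2).eval 0‖ ∧
      ∀ k < N, ‖iteratedDeriv k (padeResidual f c) 0‖ ≤ D * δ * ‖c‖ := by
  have h0E : (0 : ℂ) ∈ E := hρE (by simp [hρ.le])
  obtain ⟨C, hC, hstab⟩ := exists_norm_coeffPair_le (hf.analyticAt (hE.mem_nhds h0E)) N hinj
  set B : ℝ := (m + 1 : ℕ) + (n + 1 : ℕ) * F with hB
  have hB0 : 0 ≤ B := by positivity
  set A : ℝ := N.factorial * (2 / ρ) ^ N * (N * 2 ^ N) / ρ ^ N with hA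
  have hA0 : 0 ≤ A := by positivity
  -- The second bound gives `2 * C * (A * B) * δ ≤ 1`, so the term in `‖c‖` produced by the
  -- stability estimate is at most half of `‖c‖` and is absorbed on the left. This doubles the
  -- constant to `2 * C`.
  refine ⟨min (ρ / 2) (1 / (2 * C * (A * B) + 1)), lt_min (by positivity) (by positivity),
    2 * C, by positivity, A * B, by positivity, fun δ hδ hδ₀ c v w hv hres hw => ?_⟩
  have hjet : ∀ k < N, ‖iteratedDeriv k (padeResidual f c) 0‖ ≤ A * B * δ * ‖c‖ := by
    intro k hk
    have heq : padeResidual f c =ᶠ[𝓝 0] fun z => v z * ∏ j, (z - w j) := by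
      filter_upwards [hE.mem_nhds h0E] with z hz using hres z hz
    rw [heq.iteratedDeriv_eq]
    refine (norm_iteratedDeriv_mul_prod_le hE hv hρ hρ1 hρE hw hδ (hδ₀.trans (min_le_left _ _))
      (M := B * ‖c‖) (by positivity) (fun z hz => ?_) hk).trans (le_of_eq (by rw [hA]; ring))
    rw [← hres z (hρE (by simp [hz]))]
    exact norm_padeResidual_le c (by linarith) (hF z hz.le)
  refine ⟨?_, hjet⟩
  have h1 := hstab c (A * B * δ * ‖c‖ + ‖(ofFn (n + 1) c.2).eval 0‖) (by positivity)
    (fun k hk => (hjet k hk).trans (le_add_of_nonneg_right (norm_nonneg _)))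
    (le_add_of_nonneg_left (by positivity))
  have h2 : δ * (2 * C * (A * B)) ≤ 1 := by
    have h3 : δ * (2 * C * (A * B) + 1) ≤ 1 :=
      (le_div_iff₀ (by positivity)).1 (hδ₀.trans (min_le_right _ _))
    linarith
  have h4 : δ * (2 * C * (A * B)) * ‖c‖ ≤ 1 * ‖c‖ :=
    mul_le_mul_of_nonneg_right h2 (norm_nonneg _)
  linarith

open Classical in
/-- Linearized interpolants with denominators normalized to `1` at the origin and nodes of modulus
at most `δ` differ from the Padé approximant by `O(δ)`. -/
theorem exists_norm_quotient_sub_le_of_normalized {E : Set ℂ} (hE : IsOpen E) (h0E : (0 : ℂ) ∈ E)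
    {f : ℂ → ℂ} (hf : DifferentiableOn ℂ f E) {m n N : ℕ}
    (hinj : ∀ p q : ℂ[X], PolyDegLE p m → PolyDegLE q n →
      VanishesToOrder (fun z => p.eval z - q.eval z * f z) N → q.eval 0 = 0 → p = 0 ∧ q = 0)
    {c₀ : CoeffPair m n} {v₀ : ℂ → ℂ} (hv₀ : DifferentiableOn ℂ v₀ E)
    (hres₀ : ∀ z ∈ E, padeResidual f c₀ z = v₀ z * z ^ N)
    (hc₀ : (ofFn (n + 1) c₀.2).eval 0 = 1) :
    ∃ δ₀ > 0, ∃ C : ℝ, 0 ≤ C ∧ ∀ δ, 0 ≤ δ → δ ≤ δ₀ →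
      ∀ (c : CoeffPair m n) (v : ℂ → ℂ) (w : Fin N → ℂ), DifferentiableOn ℂ v E →
      (∀ z ∈ E, padeResidual f c z = v z * ∏ j, (z - w j)) → (∀ j, ‖w j‖ ≤ δ) →
      (c = 0 ∨ (ofFn (n + 1) c.2).eval 0 ≠ 0) ∧ ((ofFn (n + 1) c.2).eval 0 = 1 →
      ∀ z, ‖z‖ ≤ δ → ‖v z - v₀ 0‖ ≤ C * δ ∧ ‖(ofFn (n + 1) c.2).eval z - 1‖ ≤ C * δ) := by
  obtain ⟨ρ, hρ, hρ1, hρE, F, hF0, hF⟩ := exists_closedBall_subset_norm_le hE h0E hf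
  obtain ⟨δ₁, hδ₁, C₁, hC₁, D, hD, hmain⟩ :=
    exists_norm_coeff_le_of_nodes hE hf hρ hρ1 hρE hF0 hF hinj
  have hfa := hf.analyticAt (hE.mem_nhds h0E)
  obtain ⟨C₂, hC₂, hstab⟩ := exists_norm_coeffPair_le hfa N hinj
  obtain ⟨δ₂, hδ₂, C₃, hC₃, hv₀'⟩ :=
    exists_norm_sub_le_mul (hv₀.differentiableAt (hE.mem_nhds h0E))
  obtain ⟨δ₃, hδ₃, C₄, hC₄, hQ'⟩ :=
    exists_norm_sub_le_mul ((ofFn (n + 1) c₀.2).differentiable 0)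
  set B : ℝ := (m + 1 : ℕ) + (n + 1 : ℕ) * F with hB
  have hB0 : 0 ≤ B := by positivity
  set C₅ : ℝ := (B * C₁ * (2 / ρ) ^ N * (N * 2 ^ N) + B * (C₂ * (D * C₁))) / ρ ^ N with hC₅
  have hC₅0 : 0 ≤ C₅ := by positivity
  set C₆ : ℝ := (n + 1 : ℕ) * (C₂ * (D * C₁)) + C₄ with hC₆
  have hC₆0 : 0 ≤ C₆ := by positivity
  refine ⟨min (min δ₁ (ρ / 2)) (min δ₂ δ₃), by positivity, max (C₅ + C₃) C₆,
    le_max_of_le_right hC₆0, fun δ hδ hδle c v w hv hres hw => ?_⟩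
  have hle₁ : δ ≤ δ₁ := hδle.trans ((min_le_left _ _).trans (min_le_left _ _))
  have hleρ : δ ≤ ρ / 2 := hδle.trans ((min_le_left _ _).trans (min_le_right _ _))
  have hle₂ : δ ≤ δ₂ := hδle.trans ((min_le_right _ _).trans (min_le_left _ _))
  have hle₃ : δ ≤ δ₃ := hδle.trans ((min_le_right _ _).trans (min_le_right _ _))
  obtain ⟨hcle, hjet⟩ := hmain δ hδ hle₁ c v w hv hres hw
  refine ⟨?_, fun hc z hz => ?_⟩
  · rw [or_iff_not_imp_right, not_not]
    intro h
    rw [h, norm_zero, mul_zero] at hcle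
    exact norm_le_zero_iff.1 hcle
  rw [hc, norm_one, mul_one] at hcle
  have hdiff : ‖c - c₀‖ ≤ C₂ * (D * C₁) * δ := by
    have hz₀ : ∀ k < N, iteratedDeriv k (padeResidual f c₀) 0 = 0 := by
      intro k hk
      have heq : padeResidual f c₀ =ᶠ[𝓝 0] fun z => v₀ z * z ^ N := by
        filter_upwards [hE.mem_nhds h0E] with z hz using hres₀ z hz
      rw [heq.iteratedDeriv_eq]
      exact iteratedDeriv_mul_pow_eq_zero (hv₀.analyticAt (hE.mem_nhds h0E)) hk
    refine (hstab (c - c₀) (D * δ * C₁) (by positivity) (fun k hk => ?_) ?_).trans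
      (le_of_eq (by ring))
    · rw [padeResidual_sub, iteratedDeriv_fun_sub (analyticAt_padeResidual hfa c).contDiffAt
        (analyticAt_padeResidual hfa c₀).contDiffAt, hz₀ k hk, sub_zero]
      exact (hjet k hk).trans (by gcongr)
    · rw [Prod.snd_sub, map_sub, eval_sub, hc, hc₀, sub_self, norm_zero]
      positivity
  constructor
  · have hvb : ∀ y : ℂ, ‖y‖ ≤ ρ → ‖v y‖ ≤ B * C₁ * (2 / ρ) ^ N := fun y hy =>
      norm_le_of_norm_mul_prod_le hv hρ hρE hw hleρ (fun y hy => by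
        rw [← hres y (hρE (by simp [hy]))]
        exact (norm_padeResidual_le c (by linarith) (hF y hy.le)).trans (by gcongr)) hy
    have hvv : ‖v z - v₀ z‖ ≤ C₅ * δ := by
      refine norm_le_on_closedBall (hv.sub hv₀) hρ hρE (fun y hy => ?_) (by linarith)
      have hyE : y ∈ E := hρE (by simp [hy])
      -- Two sources of error on the circle: the change of coefficients and the shift of the nodes
      -- away from 0. Dividing by ρ^N and applying the maximum principle bounds `v - v₀` inside.
      have hid : (v y - v₀ y) * y ^ N =
          padeResidual f (c - c₀) y - v y * (∏ j, (y - w j) - y ^ N) := by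
        rw [padeResidual_sub]
        simp only [hres y hyE, hres₀ y hyE]
        ring
      have h1 : ‖(v y - v₀ y) * y ^ N‖ ≤
          B * (C₂ * (D * C₁) * δ) + B * C₁ * (2 / ρ) ^ N * (N * 2 ^ N * δ) := by
        rw [hid]
        refine (norm_sub_le _ _).trans (add_le_add ?_ ?_)
        · exact (norm_padeResidual_le _ (by linarith) (hF y hy.le)).trans (by gcongr)
        · rw [norm_mul]
          gcongr
          · exact hvb y hy.le
          · exact norm_prod_sub_sub_pow_le (by linarith) (by linarith) w hw
      rw [norm_mul, norm_pow, hy, ← le_div_iff₀ (by positivity)] at h1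
      exact h1.trans (le_of_eq (by rw [hC₅]; ring))
    calc ‖v z - v₀ 0‖ ≤ ‖v z - v₀ z‖ + ‖v₀ z - v₀ 0‖ := norm_sub_le_norm_sub_add_norm_sub _ _ _
      _ ≤ C₅ * δ + C₃ * δ := add_le_add hvv
        ((hv₀' z (by linarith)).trans (by gcongr))
      _ = (C₅ + C₃) * δ := by ring
      _ ≤ _ := by gcongr; exact le_max_left _ _
  · have h1 : ‖(ofFn (n + 1) c.2).eval z - (ofFn (n + 1) c₀.2).eval z‖ ≤
        (n + 1 : ℕ) * (C₂ * (D * C₁) * δ) := by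
      rw [← eval_sub, ← map_sub, ← Prod.snd_sub]
      refine (norm_eval_ofFn_le _ (by linarith)).trans ?_
      gcongr
      exact (norm_snd_le _).trans hdiff
    have h2 := hQ' z (by linarith)
    rw [hc₀] at h2
    calc _ ≤ _ := norm_sub_le_norm_sub_add_norm_sub _ ((ofFn (n + 1) c₀.2).eval z) _
      _ ≤ (n + 1 : ℕ) * (C₂ * (D * C₁) * δ) + C₄ * δ :=
        add_le_add h1 (h2.trans (by gcongr))
      _ = C₆ * δ := by rw [hC₆]; ring
      _ ≤ _ := by gcongr; exact le_max_right _ _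

open Classical in
-- Scaling p, q and v by the same constant leaves v/q unchanged, so both denominators may be
-- normalized at 0.
theorem exists_norm_quotient_sub_le {E : Set ℂ} (hE : IsOpen E) (h0E : (0 : ℂ) ∈ E)
    {f : ℂ → ℂ} (hf : DifferentiableOn ℂ f E) {m n N : ℕ}
    (hinj : ∀ p q : ℂ[X], PolyDegLE p m → PolyDegLE q n →
      VanishesToOrder (fun z => p.eval z - q.eval z * f z) N → q.eval 0 = 0 → p = 0 ∧ q = 0)
    {P Q : ℂ[X]} (hP : PolyDegLE P m) (hQ : PolyDegLE Q n)
    {v₀ : ℂ → ℂ} (hv₀ : DifferentiableOn ℂ v₀ E)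
    (hres₀ : ∀ z ∈ E, P.eval z - Q.eval z * f z = v₀ z * z ^ N) (hQ0 : Q.eval 0 ≠ 0) :
    ∃ δ₀ > 0, ∃ C : ℝ, 0 ≤ C ∧ ∀ δ, 0 ≤ δ → δ ≤ δ₀ →
      ∀ (p q : ℂ[X]) (v : ℂ → ℂ) (w : Fin N → ℂ), PolyDegLE p m → PolyDegLE q n → q ≠ 0 →
      DifferentiableOn ℂ v E →
      (∀ z ∈ E, p.eval z - q.eval z * f z = v z * ∏ j, (z - w j)) → (∀ j, ‖w j‖ ≤ δ) →
      ∀ z, ‖z‖ ≤ δ → q.eval z ≠ 0 ∧ ‖v z / q.eval z - v₀ 0 / Q.eval 0‖ ≤ C * δ := by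
  have hcoe : ∀ (t : ℂ) (p q : ℂ[X]), PolyDegLE p m → PolyDegLE q n → ∀ z,
      padeResidual f (t • ((toFn (m + 1) p, toFn (n + 1) q) : CoeffPair m n)) z =
        t * (p.eval z - q.eval z * f z) := by
    intro t p q hp hq z
    rw [padeResidual_smul]
    simp only [padeResidual, ofFn_toFn_of_polyDegLE hp, ofFn_toFn_of_polyDegLE hq]
  have hcoe2 : ∀ (t : ℂ) (p q : ℂ[X]), PolyDegLE q n → ∀ z,
      (ofFn (n + 1) (t • ((toFn (m + 1) p, toFn (n + 1) q) : CoeffPair m n)).2).eval z =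
        t * q.eval z := by
    intro t p q hq z
    rw [Prod.smul_snd, map_smul, ofFn_toFn_of_polyDegLE hq, eval_smul, smul_eq_mul]
  obtain ⟨δ₀, hδ₀, C, hC, hmain⟩ := exists_norm_quotient_sub_le_of_normalized hE h0E hf hinj
    (c₀ := (Q.eval 0)⁻¹ • (toFn (m + 1) P, toFn (n + 1) Q)) (hv₀.const_mul (Q.eval 0)⁻¹)
    (fun z hz => by rw [hcoe _ P Q hP hQ, hres₀ z hz]; ring)
    (by rw [hcoe2 _ P Q hQ, inv_mul_cancel₀ hQ0])
  set a := (Q.eval 0)⁻¹ * v₀ 0 with ha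
  -- The second bound gives `C * δ ≤ 1 / 2`, so the normalized denominator has modulus at least 1/2;
  -- this is the factor 2 in the constant.
  refine ⟨min δ₀ (1 / (2 * C + 1)), by positivity, 2 * (C + ‖a‖ * C), by positivity,
    fun δ hδ hδle p q v w hp hq hq0 hv hres hw z hz => ?_⟩
  have hle₀ : δ ≤ δ₀ := hδle.trans (min_le_left _ _)
  have hCδ : C * δ ≤ 1 / 2 := by
    have h3 : δ * (2 * C + 1) ≤ 1 :=
      (le_div_iff₀ (by positivity)).1 (hδle.trans (min_le_right _ _))
    linarith
  have hne : q.eval 0 ≠ 0 := by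
    have h := (hmain δ hδ hle₀ ((1 : ℂ) • (toFn (m + 1) p, toFn (n + 1) q)) v w hv
      (fun z hz => by rw [hcoe _ p q hp hq, one_mul, hres z hz]) hw).1
    rw [hcoe2 _ p q hq, one_mul, one_smul] at h
    refine h.resolve_left fun h0 => hq0 ?_
    rw [← ofFn_toFn_of_polyDegLE hq, (Prod.mk_eq_zero.1 h0).2, map_zero]
  obtain ⟨h1, h2⟩ := (hmain δ hδ hle₀ ((q.eval 0)⁻¹ • (toFn (m + 1) p, toFn (n + 1) q))
    (fun z => (q.eval 0)⁻¹ * v z) w (hv.const_mul _)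
    (fun z hz => by rw [hcoe _ p q hp hq, hres z hz]; ring) hw).2
    (by rw [hcoe2 _ p q hq, inv_mul_cancel₀ hne]) z hz
  rw [hcoe2 _ p q hq] at h2
  set y := (q.eval 0)⁻¹ * q.eval z with hy
  set u := (q.eval 0)⁻¹ * v z with hu
  have hyn : 1 / 2 ≤ ‖y‖ := by
    have := norm_sub_norm_le 1 (1 - y)
    rw [norm_one, sub_sub_cancel, norm_sub_rev] at this
    linarith
  have hy0 : y ≠ 0 := by
    intro h; rw [h, norm_zero] at hyn; linarith
  refine ⟨right_ne_zero_of_mul hy0, ?_⟩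
  have hid : v z / q.eval z - v₀ 0 / Q.eval 0 = ((u - a) - a * (y - 1)) / y := by
    have hquot : v z / q.eval z = u / y := by
      rw [hu, hy, mul_div_mul_left _ _ (inv_ne_zero hne)]
    rw [hquot, show v₀ 0 / Q.eval 0 = a by rw [ha]; ring]
    field_simp
    ring
  rw [hid, norm_div, div_le_iff₀ (by linarith)]
  calc _ ≤ ‖u - a‖ + ‖a‖ * ‖y - 1‖ := (norm_sub_le _ _).trans_eq (by rw [norm_mul])
    _ ≤ C * δ + ‖a‖ * (C * δ) := by gcongr
    _ = 2 * (C + ‖a‖ * C) * δ * (1 / 2) := by ring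
    _ ≤ _ := by gcongr

/-! ### Error expansion for small nodes -/

theorem leading_error_coeff_eq {E : Set ℂ} (hE : IsOpen E) (h0E : (0 : ℂ) ∈ E)
    {f : ℂ → ℂ} {N : ℕ} {P Q : ℂ[X]} {v₀ : ℂ → ℂ} (hv₀ : DifferentiableOn ℂ v₀ E)
    (hres₀ : ∀ z ∈ E, P.eval z - Q.eval z * f z = v₀ z * z ^ N) (hQ0 : Q.eval 0 ≠ 0) {a : ℂ}
    (ha : (fun z : ℂ => ratVal (algebraMap ℂ[X] (RatFunc ℂ) P / algebraMap ℂ[X] (RatFunc ℂ) Q) z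
      - f z - a * z ^ N) =O[𝓝 0] fun z : ℂ => z ^ (N + 1)) :
    v₀ 0 / Q.eval 0 = a := by
  have hcont : ContinuousAt (fun z => v₀ z / Q.eval z - a) 0 :=
    ((hv₀.continuousOn.continuousAt (hE.mem_nhds h0E)).div Q.continuous.continuousAt hQ0).sub
      continuousAt_const
  have hQne : ∀ᶠ z in 𝓝 (0 : ℂ), Q.eval z ≠ 0 := Q.continuous.continuousAt.eventually_ne hQ0
  have hO : (fun z => v₀ z / Q.eval z - a) =O[𝓝[≠] 0] fun z : ℂ => z := by
    obtain ⟨c, hc⟩ := (ha.mono (nhdsWithin_le_nhds (s := {0}ᶜ))).bound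
    refine IsBigO.of_bound c ?_
    filter_upwards [hc, nhdsWithin_le_nhds hQne, nhdsWithin_le_nhds (hE.mem_nhds h0E),
      self_mem_nhdsWithin] with z hz hQz hzE hz0
    have hz0' : (0 : ℝ) < ‖z‖ ^ N := pow_pos (norm_pos_iff.2 hz0) N
    have hid : P.eval z / Q.eval z - f z - a * z ^ N = (v₀ z / Q.eval z - a) * z ^ N := by
      have := hres₀ z hzE
      field_simp
      linear_combination this
    rw [(eval_denom_ne_zero_and_ratVal_div P Q hQz).2, hid, norm_mul, norm_pow, norm_pow, pow_succ,
      ← mul_assoc, mul_right_comm] at hz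
    exact le_of_mul_le_mul_right hz hz0'
  have hlim := hO.trans_tendsto (tendsto_id.mono_left (nhdsWithin_le_nhds (s := {0}ᶜ)))
  exact sub_eq_zero.1 (tendsto_nhds_unique (hcont.tendsto.mono_left nhdsWithin_le_nhds) hlim)

/-- The error of Newton--Padé approximants with nodes in a shrinking disc, uniformly in the
nodes. -/
theorem exists_norm_error_sub_le (m n : ℕ) {E : Set ℂ} (hE : IsOpen E) (h0E : (0 : ℂ) ∈ E)
    {f : ℂ → ℂ} (hf : DifferentiableOn ℂ f E) {rP : RatFunc ℂ} (hrP : IsPade E f m n rP)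
    (hnd : IsNondegenerate m n rP) {a : ℂ}
    (ha : (fun z : ℂ => ratVal rP z - f z - a * z ^ (m + n + 1))
      =O[𝓝 0] fun z : ℂ => z ^ (m + n + 2)) {R : ℝ} (hR : 0 < R) :
    ∃ ε₀ > 0, ∃ C : ℝ, 0 ≤ C ∧ ∀ ε : ℝ, 0 < ε → ε ≤ ε₀ → ∀ x : Fin (m + n + 1) → ℂ,
      (∀ j, ‖x j‖ ≤ R) → ∀ r, IsNewtonPade E f m n (fun j => ε * x j) r → ∀ z : ℂ, ‖z‖ ≤ R →
        r.denom.eval (ε * z) ≠ 0 ∧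
        ‖ratVal r (ε * z) - f (ε * z) - a * (ε : ℂ) ^ (m + n + 1) * ∏ j, (z - x j)‖ ≤
          C * ε ^ (m + n + 2) := by
  obtain ⟨-, P, Q, hP, hQ, hQne, rfl, v₀, hv₀, hres₀⟩ := hrP
  have hres₀' : ∀ z ∈ E, P.eval z - Q.eval z * f z = v₀ z * z ^ (m + n + 1) := by
    intro z hz
    rw [hres₀ z hz]; simp
  have hvan : VanishesToOrder (fun z => P.eval z - Q.eval z * f z) (m + n + 1) := by
    refine ⟨v₀, hv₀.analyticAt (hE.mem_nhds h0E), ?_⟩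
    filter_upwards [hE.mem_nhds h0E] with z hz
    rw [hres₀' z hz, mul_comm]
  have hinj := fun p q hp hq hpq h0 =>
    numerator_denominator_eq_zero_of_eval_zero (p := p) (q := q) hnd hP hQ hQne hvan hp hq hpq h0
  have hQ0 : Q.eval 0 ≠ 0 := fun h => hQne (hinj P Q hP hQ hvan h).2
  have hva := leading_error_coeff_eq hE h0E hv₀ hres₀' hQ0 ha
  obtain ⟨δ₀, hδ₀, C, hC, hmain⟩ :=
    exists_norm_quotient_sub_le hE h0E hf hinj hP hQ hv₀ hres₀' hQ0
  obtain ⟨δ₁, hδ₁, hball⟩ := Metric.nhds_basis_closedBall.mem_iff.1 (hE.mem_nhds h0E)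
  refine ⟨min δ₀ δ₁ / R, by positivity, C * R * (2 * R) ^ (m + n + 1), by positivity,
    fun ε hε hεle x hx r hr z hz => ?_⟩
  obtain ⟨-, p, q, hp, hq, hqne, rfl, v, hv, hres⟩ := hr
  rw [le_div_iff₀ hR] at hεle
  have hscale : ∀ y : ℂ, ‖y‖ ≤ R → ‖(ε : ℂ) * y‖ ≤ ε * R := fun y hy => by
    rw [norm_mul, Complex.norm_real, Real.norm_of_nonneg hε.le]
    gcongr
  obtain ⟨hqz, hquot⟩ := hmain (ε * R) (by positivity) (hεle.trans (min_le_left _ _)) p q v _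
    hp hq hqne hv hres (fun j => hscale _ (hx j)) (ε * z) (hscale z hz)
  rw [hva] at hquot
  obtain ⟨hd, hval⟩ := eval_denom_ne_zero_and_ratVal_div p q hqz
  refine ⟨hd, ?_⟩
  have hzE : (ε : ℂ) * z ∈ E :=
    hball (by simpa using (hscale z hz).trans (hεle.trans (min_le_right _ _)))
  have hprod : ∏ j, ((ε : ℂ) * z - ε * x j) = (ε : ℂ) ^ (m + n + 1) * ∏ j, (z - x j) := by
    simp only [← mul_sub, Finset.prod_mul_distrib, Finset.prod_const, Finset.card_univ,
      Fintype.card_fin]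
  have hid : p.eval (ε * z) / q.eval (ε * z) - f (ε * z)
      - a * (ε : ℂ) ^ (m + n + 1) * ∏ j, (z - x j) =
      (v (ε * z) / q.eval (ε * z) - a) * ((ε : ℂ) ^ (m + n + 1) * ∏ j, (z - x j)) := by
    have := hres _ hzE
    rw [hprod] at this
    field_simp
    linear_combination this
  have hpb : ‖∏ j, (z - x j)‖ ≤ (2 * R) ^ (m + n + 1) := by
    rw [norm_prod]
    calc _ ≤ ∏ _j : Fin (m + n + 1), (2 * R) :=
          Finset.prod_le_prod (fun _ _ => norm_nonneg _) fun j _ =>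
            (norm_sub_le _ _).trans (by linarith [hx j])
      _ = _ := by rw [Finset.prod_const, Finset.card_fin]
  rw [hval, hid, norm_mul, norm_mul, norm_pow, Complex.norm_real, Real.norm_of_nonneg hε.le]
  calc _ ≤ C * (ε * R) * (ε ^ (m + n + 1) * (2 * R) ^ (m + n + 1)) := by gcongr
    _ = _ := by ring

/-! ### Chebyshev polynomials of compact sets -/

theorem exists_perm_of_prod_X_sub_C_eq {N : ℕ} {x y : Fin N → ℂ}
    (h : ∏ j, (X - C (x j)) = ∏ j, (X - C (y j))) : ∃ σ : Equiv.Perm (Fin N), x ∘ σ = y := by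
  classical
  have hroots : ∀ w : Fin N → ℂ, (∏ j, (X - C (w j))).roots = Finset.univ.val.map w := by
    intro w
    rw [← roots_multiset_prod_X_sub_C (Finset.univ.val.map w), Multiset.map_map]
    rfl
  have hmap : Finset.univ.val.map x = Finset.univ.val.map y := by
    rw [← hroots, ← hroots, h]
  have hcard : ∀ b, Fintype.card {i // y i = b} = Fintype.card {i // x i = b} := by
    intro b
    have := congrArg (Multiset.count b) hmap
    rw [Multiset.count_map, Multiset.count_map] at this
    rw [Fintype.card_subtype, Fintype.card_subtype, Finset.card_def, Finset.card_def,
      Finset.filter_val, Finset.filter_val]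
    simp only [eq_comm (b := b)]
    exact this.symm
  exact ⟨Equiv.ofFiberEquiv fun b => Fintype.equivOfCardEq (hcard b), funext fun i =>
    Equiv.ofFiberEquiv_map _ i⟩

theorem exists_polyNormOn_eq {K : Set ℂ} (hK : IsCompact K) (hKne : K.Nonempty) (p : ℂ[X]) :
    ∃ z ∈ K, polyNormOn K p = ‖p.eval z‖ :=
  hK.exists_sSup_image_eq hKne p.continuous.norm.continuousOn

theorem norm_eval_le_polyNormOn {K : Set ℂ} (hK : IsCompact K) (p : ℂ[X]) {z : ℂ} (hz : z ∈ K) :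
    ‖p.eval z‖ ≤ polyNormOn K p :=
  le_csSup (hK.image p.continuous.norm).bddAbove (Set.mem_image_of_mem _ hz)

/-- A monic polynomial whose extremal points are too few does not have least maximum norm. -/
theorem exists_degree_lt_norm_sub_lt {K : Set ℂ} (hK : IsCompact K) {u : ℂ[X]} {t : ℝ}
    (ht : 0 < t) (hu : ∀ z ∈ K, ‖u.eval z‖ ≤ t) {S : Finset ℂ}
    (hS : ∀ z ∈ K, ‖u.eval z‖ = t → z ∈ S) :
    ∃ h : ℂ[X], h.degree < S.card ∧ ∀ z ∈ K, ‖(u - h).eval z‖ < t := by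
  classical
  set h := Lagrange.interpolate S id fun z => u.eval z with hh
  have hdeg : h.degree < S.card := Lagrange.degree_interpolate_lt _ Function.injective_id.injOn
  have hval : ∀ z ∈ S, h.eval z = u.eval z := fun z hz =>
    Lagrange.eval_interpolate_at_node (v := id) _ Function.injective_id.injOn hz
  by_contra! hcon
  -- A small multiple of the interpolant should lower the norm. If all multiples 1/(k + 1) fail, the
  -- points of failure accumulate at an extremal point of `u`.
  have hδ : ∀ k : ℕ, ∃ z ∈ K, t ≤ ‖(u - C (1 / ((k : ℂ) + 1)) * h).eval z‖ := fun k =>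
    hcon _ ((degree_C_mul (one_div_ne_zero k.cast_add_one_ne_zero)).trans_lt hdeg)
  choose z hzK hz using hδ
  obtain ⟨y, hyK, φ, hφ, hlim⟩ := hK.tendsto_subseq hzK
  -- Since u - δh is a convex combination of u and u - h, and |u| ≤ t, failure for u - δh implies
  -- failure for u - h. But u - h vanishes at the accumulation point.
  have hbound : ∀ k : ℕ, t ≤ ‖(u - h).eval (z k)‖ := by
    intro k
    set δ : ℝ := 1 / ((k : ℝ) + 1) with hδ
    have hδ0 : 0 < δ := by positivity
    have hδ1 : δ ≤ 1 := by
      rw [hδ, div_le_one (by positivity)]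
      have : (0 : ℝ) ≤ k := k.cast_nonneg
      linarith
    have hid : (u - C (1 / ((k : ℂ) + 1)) * h).eval (z k) =
        ((1 - δ : ℝ) : ℂ) * u.eval (z k) + (δ : ℂ) * (u - h).eval (z k) := by
      simp only [eval_sub, eval_mul, eval_C, hδ]
      push_cast
      ring
    have h1 := hz k
    rw [hid] at h1
    have h2 : t ≤ (1 - δ) * t + δ * ‖(u - h).eval (z k)‖ := by
      refine h1.trans ((norm_add_le _ _).trans ?_)
      rw [norm_mul, norm_mul, Complex.norm_real, Complex.norm_real,
        Real.norm_of_nonneg hδ0.le, Real.norm_of_nonneg (sub_nonneg.2 hδ1)]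
      have := mul_le_mul_of_nonneg_left (hu _ (hzK k)) (sub_nonneg.2 hδ1)
      linarith
    have h3 : δ * t ≤ δ * ‖(u - h).eval (z k)‖ := by linarith
    exact le_of_mul_le_mul_left h3 hδ0
  have hyt : t ≤ ‖u.eval y‖ := by
    have hc : Tendsto (fun k : ℕ => (1 / ((k : ℂ) + 1))) atTop (𝓝 0) :=
      tendsto_one_div_add_atTop_nhds_zero_nat
    have h1 : Tendsto (fun k => ‖(u - C (1 / ((φ k : ℂ) + 1)) * h).eval (z (φ k))‖) atTop
        (𝓝 ‖u.eval y - 0 * h.eval y‖) := by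
      simp only [eval_sub, eval_mul, eval_C]
      exact (((u.continuous.tendsto y).comp hlim).sub
        ((hc.comp hφ.tendsto_atTop).mul ((h.continuous.tendsto y).comp hlim))).norm
    rw [zero_mul, sub_zero] at h1
    exact ge_of_tendsto' h1 fun k => hz (φ k)
  have hyS := hS y hyK ((hu y hyK).antisymm hyt)
  have h2 : Tendsto (fun k => ‖(u - h).eval (z (φ k))‖) atTop (𝓝 ‖(u - h).eval y‖) :=
    (((u - h).continuous.tendsto y).comp hlim).norm
  have h3 := ge_of_tendsto' h2 fun k => hbound (φ k)
  rw [eval_sub, hval y hyS, sub_self, norm_zero] at h3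
  linarith

/-- Uniqueness of the monic polynomial of least maximum norm on an infinite compact set. -/
theorem monic_eq_of_norm_le {K : Set ℂ} (hK : IsCompact K) (hKinf : K.Infinite) {N : ℕ}
    (hN : 0 < N) {t : ℝ}
    (hmin : ∀ p : ℂ[X], p.Monic → p.natDegree = N → ∃ z ∈ K, t ≤ ‖p.eval z‖)
    {p q : ℂ[X]} (hp : p.Monic) (hpN : p.natDegree = N) (hpt : ∀ z ∈ K, ‖p.eval z‖ ≤ t)
    (hq : q.Monic) (hqN : q.natDegree = N) (hqt : ∀ z ∈ K, ‖q.eval z‖ ≤ t) : p = q := by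
  set d := p - q with hd
  have hdN : d.natDegree < N := IsMonicOfDegree.natDegree_sub_lt hN.ne' ⟨hpN, hp⟩ ⟨hqN, hq⟩
  have hddeg : d.degree < N := degree_le_natDegree.trans_lt (by exact_mod_cast hdN)
  -- The midpoint of p and q. At its extremal points the triangle inequality is an equality, so p =
  -- q there: these points are among the fewer than N roots of `d`, too few for a minimal
  -- polynomial.
  set u := p - C (1 / 2) * d with hu
  have huval : ∀ z, u.eval z = (1 / 2) * (p.eval z + q.eval z) := by
    intro z
    simp only [hu, hd, eval_sub, eval_mul, eval_C]
    ring
  have hut : ∀ z ∈ K, ‖u.eval z‖ ≤ t := by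
    intro z hz
    rw [huval, norm_mul, norm_div, norm_one, RCLike.norm_ofNat]
    have := norm_add_le (p.eval z) (q.eval z)
    linarith [hpt z hz, hqt z hz]
  have hd0 : ∀ z ∈ K, ‖u.eval z‖ = t → d.eval z = 0 := by
    intro z hz h
    rw [huval, norm_mul, norm_div, norm_one, RCLike.norm_ofNat] at h
    have h1 := norm_add_le (p.eval z) (q.eval z)
    have h2 := hpt z hz
    have h3 := hqt z hz
    rw [hd, eval_sub, sub_eq_zero]
    exact eq_of_norm_eq_of_norm_add_eq (by linarith) (by linarith)
  by_contra hne
  have hdne : d ≠ 0 := sub_ne_zero.2 hne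
  have ht : 0 < t := by
    -- If t ≤ 0, every point of K is extremal, hence a root of `d`.
    refine lt_of_not_ge fun ht => hKinf ?_
    refine (d.roots.toFinset.finite_toSet).subset fun z hz => ?_
    have h1 : ‖u.eval z‖ = t :=
      (hut z hz).antisymm (ht.trans (norm_nonneg _))
    simpa [hdne] using hd0 z hz h1
  obtain ⟨h, hh, hlt⟩ := exists_degree_lt_norm_sub_lt hK ht hut (S := d.roots.toFinset)
    fun z hz h => by simpa [hdne] using hd0 z hz h
  have hhN : h.degree < N := hh.trans_le (by
    exact_mod_cast (Multiset.toFinset_card_le _).trans ((card_roots' d).trans hdN.le))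
  have hsmall : (C (1 / 2) * d + h).degree < p.degree := by
    rw [degree_eq_natDegree hp.ne_zero, hpN]
    exact (degree_add_le _ _).trans_lt (max_lt ((degree_C_mul (by norm_num)).trans_lt hddeg) hhN)
  have huh : u - h = p - (C (1 / 2) * d + h) := by rw [hu]; ring
  obtain ⟨z, hz, hzt⟩ := hmin (u - h) (huh ▸ hp.sub_of_left hsmall) (by
    rw [huh, natDegree_eq_of_degree_eq (degree_sub_eq_left_of_degree_lt hsmall), hpN])
  exact absurd (hlt z hz) (not_lt.2 hzt)

theorem monic_prod_X_sub_C_fin {N : ℕ} (x : Fin N → ℂ) : (∏ j, (X - C (x j))).Monic :=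
  monic_prod_of_monic _ _ fun j _ => monic_X_sub_C (x j)

theorem natDegree_prod_X_sub_C_fin {N : ℕ} (x : Fin N → ℂ) :
    (∏ j, (X - C (x j))).natDegree = N := by
  rw [natDegree_prod_of_monic _ _ fun j _ => monic_X_sub_C (x j)]
  simp

theorem norm_eval_prod_X_sub_C {N : ℕ} (x : Fin N → ℂ) (z : ℂ) :
    ‖(∏ j, (X - C (x j))).eval z‖ = ∏ j, ‖z - x j‖ := by
  rw [eval_prod, norm_prod]
  simp

theorem maxNodeProd_eq_polyNormOn (K : Set ℂ) {N : ℕ} (τ : Fin N → ℂ) :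
    maxNodeProd K τ = polyNormOn K (∏ j, (X - C (τ j))) := by
  simp only [maxNodeProd, polyNormOn, norm_eval_prod_X_sub_C]

theorem IsChebyshevNodes.exists_maxNodeProd_le {K : Set ℂ} (hK : IsCompact K)
    (hKne : K.Nonempty) {N : ℕ} {τ : Fin N → ℂ} (hτ : IsChebyshevNodes K N τ) (hN : 0 < N)
    {p : ℂ[X]} (hp : p.Monic) (hpN : p.natDegree = N) :
    ∃ z ∈ K, maxNodeProd K τ ≤ ‖p.eval z‖ := by
  obtain ⟨g, -, hmin, hg⟩ := hτ
  have hlt := IsMonicOfDegree.natDegree_sub_lt hN.ne' ⟨natDegree_X_pow N, monic_X_pow N⟩ ⟨hpN, hp⟩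
  have h := hmin (X ^ N - p) (fun i hi => coeff_eq_zero_of_natDegree_lt (by omega))
  rw [sub_sub_cancel, hg, ← maxNodeProd_eq_polyNormOn] at h
  obtain ⟨z, hz, hz'⟩ := exists_polyNormOn_eq hK hKne p
  exact ⟨z, hz, h.trans hz'.le⟩

/-- Nodes in a compact set whose node polynomials are asymptotically of least maximum norm
converge to the Chebyshev nodes, up to ordering. -/
theorem IsChebyshevNodes.exists_perm_tendsto {K : Set ℂ} (hK : IsCompact K)
    (hKinf : K.Infinite) {N : ℕ} (hN : 0 < N) {τ : Fin N → ℂ} (hτ : IsChebyshevNodes K N τ)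
    {Θ : Set ℂ} (hΘ : IsCompact Θ) {ι : Type*} {l : Filter ι} {y : ι → Fin N → ℂ}
    (hy : ∀ᶠ i in l, ∀ j, y i j ∈ Θ)
    (hlim : ∀ η > 0, ∀ᶠ i in l, ∀ z ∈ K, ∏ j, ‖z - y i j‖ ≤ maxNodeProd K τ + η) :
    ∃ σ : ι → Equiv.Perm (Fin N), Tendsto (fun i => y i ∘ σ i) l (𝓝 τ) := by
  -- With the ordering closest to `τ`, it suffices to refute a persistent gap using any single
  -- permutation.
  have hσ : ∀ i, ∃ σ : Equiv.Perm (Fin N), ∀ π : Equiv.Perm (Fin N),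
      dist (y i ∘ σ) τ ≤ dist (y i ∘ π) τ := fun i =>
    Finite.exists_min fun π : Equiv.Perm (Fin N) => dist (y i ∘ π) τ
  choose σ hσ using hσ
  refine ⟨σ, ?_⟩
  rw [Metric.tendsto_nhds]
  by_contra! hcon
  obtain ⟨δ, hδ, hfreq⟩ := hcon
  have : (l ⊓ 𝓟 {i | δ ≤ dist (y i ∘ σ i) τ}).NeBot := frequently_iff_neBot.1 hfreq
  -- An ultrafilter replaces passing to a subsequence: along it the nodes converge in the compact
  -- product of copies of Θ, while the gap persists.
  set U := Ultrafilter.of (l ⊓ 𝓟 {i | δ ≤ dist (y i ∘ σ i) τ}) with hU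
  have hUle : (U : Filter ι) ≤ l ⊓ 𝓟 {i | δ ≤ dist (y i ∘ σ i) τ} := Ultrafilter.of_le _
  have hUl : (U : Filter ι) ≤ l := hUle.trans inf_le_left
  have hUbad : ∀ᶠ i in (U : Filter ι), δ ≤ dist (y i ∘ σ i) τ :=
    le_principal_iff.1 (hUle.trans inf_le_right)
  obtain ⟨x, -, hx⟩ := (isCompact_univ_pi fun _ : Fin N => hΘ).ultrafilter_le_nhds (U.map y)
    (by
      rw [le_principal_iff, Ultrafilter.coe_map, mem_map]
      filter_upwards [hUl hy] with i hi j _ using hi j)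
  have hx' : Tendsto y U (𝓝 x) := hx
  have hxt : ∀ z ∈ K, ∏ j, ‖z - x j‖ ≤ maxNodeProd K τ := by
    intro z hz
    refine le_of_forall_pos_le_add fun η hη => ?_
    have hc : Continuous fun w : Fin N → ℂ => ∏ j, ‖z - w j‖ := by fun_prop
    refine le_of_tendsto ((hc.tendsto x).comp hx') ?_
    filter_upwards [hUl (hlim η hη)] with i hi using hi z hz
  have heq : ∏ j, (X - C (x j)) = ∏ j, (X - C (τ j)) :=
    monic_eq_of_norm_le hK hKinf hN
      (fun p hp hpN => hτ.exists_maxNodeProd_le hK hKinf.nonempty hN hp hpN)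
      (monic_prod_X_sub_C_fin x) (natDegree_prod_X_sub_C_fin x)
      (fun z hz => (norm_eval_prod_X_sub_C x z).trans_le (hxt z hz))
      (monic_prod_X_sub_C_fin τ) (natDegree_prod_X_sub_C_fin τ)
      (fun z hz => (norm_eval_le_polyNormOn hK _ hz).trans_eq (maxNodeProd_eq_polyNormOn K τ).symm)
  obtain ⟨π, hπ⟩ := exists_perm_of_prod_X_sub_C_eq heq
  have hcomp : Tendsto (fun i => y i ∘ π) U (𝓝 τ) := by
    have hc : Continuous fun w : Fin N → ℂ => w ∘ π := by fun_prop
    rw [← hπ]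
    exact (hc.tendsto x).comp hx'
  obtain ⟨i, hi, hi'⟩ := (hUbad.and (Metric.tendsto_nhds.1 hcomp δ hδ)).exists
  exact absurd ((hσ i π).trans_lt hi') (not_lt.2 hi)

/-! ### Uniform errors on scaled sets -/

theorem uniformError_smul_le {K : Set ℂ} {f : ℂ → ℂ} {r : RatFunc ℂ} {ε B : ℝ}
    (h : ∀ z ∈ K, r.denom.eval (ε * z) ≠ 0 ∧ ‖ratVal r (ε * z) - f (ε * z)‖ ≤ B) :
    uniformError (ε • K) f r ≤ ENNReal.ofReal B := by
  refine iSup₂_le fun w hw => ?_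
  obtain ⟨z, hz, rfl⟩ := hw
  simp only [Complex.real_smul]
  rw [if_neg (h z hz).1]
  exact ENNReal.ofReal_le_ofReal (h z hz).2

theorem ofReal_le_uniformError_smul {K : Set ℂ} {f : ℂ → ℂ} {r : RatFunc ℂ} {ε : ℝ} {z : ℂ}
    (hz : z ∈ K) :
    ENNReal.ofReal ‖ratVal r (ε * z) - f (ε * z)‖ ≤ uniformError (ε • K) f r := by
  have hmem : (ε : ℂ) * z ∈ ε • K := ⟨z, hz, by simp [Complex.real_smul]⟩
  refine le_trans ?_ (le_iSup₂ (f := fun w (_ : w ∈ ε • K) =>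
    if r.denom.eval w = 0 then (⊤ : ℝ≥0∞) else ENNReal.ofReal ‖ratVal r w - f w‖) _ hmem)
  split_ifs
  · exact le_top
  · exact le_rfl

theorem div_mem_of_mem_smul {Θ : Set ℂ} {ε : ℝ} (hε : ε ≠ 0) {x : ℂ} (hx : x ∈ ε • Θ) :
    x / ε ∈ Θ ∧ (ε : ℂ) * (x / ε) = x := by
  have hε' : (ε : ℂ) ≠ 0 := Complex.ofReal_ne_zero.2 hε
  obtain ⟨θ, hθ, rfl⟩ := hx
  simp only [Complex.real_smul]
  rw [mul_div_cancel_left₀ _ hε']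
  exact ⟨hθ, rfl⟩

theorem prod_norm_sub_le_maxNodeProd {K : Set ℂ} (hK : IsCompact K) {N : ℕ} (τ : Fin N → ℂ)
    {z : ℂ} (hz : z ∈ K) : ∏ j, ‖z - τ j‖ ≤ maxNodeProd K τ := by
  rw [maxNodeProd_eq_polyNormOn, ← norm_eval_prod_X_sub_C]
  exact norm_eval_le_polyNormOn hK _ hz

/-! ### Asymptotics of interpolatory best approximants -/

theorem theorem1 (m n : ℕ)
    (E : Set ℂ) (hE : IsOpen E) (h0E : (0 : ℂ) ∈ E)
    (f : ℂ → ℂ) (hf : DifferentiableOn ℂ f E)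
    (K : Set ℂ) (hK : IsCompact K) (hKne : K.Nonempty) (hKacc : Preperfect K)
    (rP : RatFunc ℂ) (hrP : IsPade E f m n rP) (hnd : IsNondegenerate m n rP)
    (a : ℂ)
    (ha : (fun z : ℂ => ratVal rP z - f z - a * z ^ (m + n + 1))
      =O[𝓝 0] fun z : ℂ => z ^ (m + n + 2))
    (ha0 : a ≠ 0)
    (τ : Fin (m + n + 1) → ℂ) (hτ : IsChebyshevNodes K (m + n + 1) τ)
    (Θ : Set ℂ) (hΘ : IsCompact Θ) (hτΘ : ∀ j, τ j ∈ Θ)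
    (r : ℝ → RatFunc ℂ)
    (hr : ∀ᶠ ε : ℝ in 𝓝[>] 0, IsInterpolatoryBest E f m n (ε • Θ) (ε • K) (r ε)) :
    -- the rescaled interpolation nodes converge to the Chebyshev nodes, up to ordering
    (∀ x : ℝ → Fin (m + n + 1) → ℂ,
      (∀ᶠ ε : ℝ in 𝓝[>] 0, (∀ j, x ε j ∈ ε • Θ) ∧ IsNewtonPade E f m n (x ε) (r ε)) →
      ∃ σ : ℝ → Equiv.Perm (Fin (m + n + 1)),
        ∀ j, Tendsto (fun ε : ℝ => x ε (σ ε j) / (ε : ℂ)) (𝓝[>] 0) (𝓝 (τ j))) ∧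
    -- the point-wise error, with a remainder that is uniform on `K`
    (∀ c : ℝ, 0 < c → ∀ᶠ ε : ℝ in 𝓝[>] 0, ∀ z ∈ K,
      (r ε).denom.eval ((ε : ℂ) * z) ≠ 0 ∧
      ‖ratVal (r ε) ((ε : ℂ) * z) - f ((ε : ℂ) * z)
        - a * (ε : ℂ) ^ (m + n + 1) * ∏ j, (z - τ j)‖ ≤ c * ε ^ (m + n + 1)) ∧
    -- the uniform error
    (∀ᶠ ε : ℝ in 𝓝[>] 0, uniformError (ε • K) f (r ε) ≠ ⊤) ∧
    ((fun ε : ℝ => (uniformError (ε • K) f (r ε)).toReal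
        - maxNodeProd K τ * ‖a‖ * ε ^ (m + n + 1))
      =O[𝓝[>] 0] fun ε : ℝ => ε ^ (m + n + 2)) := by
  have hKinf : K.Infinite := by
    obtain ⟨z, hz⟩ := hKne
    exact Set.Infinite.of_accPt (hKacc z hz)
  have ha' : 0 < ‖a‖ := norm_pos_iff.2 ha0
  obtain ⟨R, hR, hRb⟩ := (hK.isBounded.union hΘ.isBounded).exists_pos_norm_le
  have hRK : ∀ z ∈ K, ‖z‖ ≤ R := fun z hz => hRb z (Or.inl hz)
  have hRΘ : ∀ z ∈ Θ, ‖z‖ ≤ R := fun z hz => hRb z (Or.inr hz)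
  obtain ⟨ε₀, hε₀, C, hC, herr⟩ := exists_norm_error_sub_le m n hE h0E hf hrP hnd ha hR
  obtain ⟨δ₁, hδ₁, hball⟩ := Metric.nhds_basis_closedBall.mem_iff.1 (hE.mem_nhds h0E)
  set t := maxNodeProd K τ with ht
  have hnorm : ∀ {ε : ℝ}, 0 < ε → ∀ {N : ℕ} (y : Fin N → ℂ) (z : ℂ) (k : ℕ),
      ‖a * (ε : ℂ) ^ k * ∏ j, (z - y j)‖ = ‖a‖ * ε ^ k * ∏ j, ‖z - y j‖ := by
    intro ε hε N y z k
    rw [norm_mul, norm_mul, norm_pow, Complex.norm_real, Real.norm_of_nonneg hε.le, norm_prod]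
  have hsmall : ∀ᶠ ε : ℝ in 𝓝[>] 0, 0 < ε ∧ ε ≤ ε₀ ∧ ε ≤ δ₁ / R := by
    filter_upwards [Ioc_mem_nhdsGT (lt_min hε₀ (div_pos hδ₁ hR))] with ε hε
    exact ⟨hε.1, hε.2.trans (min_le_left _ _), hε.2.trans (min_le_right _ _)⟩
  have hupper : ∀ᶠ ε : ℝ in 𝓝[>] 0, uniformError (ε • K) f (r ε) ≤
      ENNReal.ofReal (‖a‖ * ε ^ (m + n + 1) * t + C * ε ^ (m + n + 2)) := by
    filter_upwards [hsmall, hr] with ε ⟨hε, hε0, hε1⟩ hbest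
    obtain ⟨s, hs⟩ := exists_isNewtonPade hE hf m n (fun j => (ε : ℂ) * τ j) fun j => hball (by
      rw [mem_closedBall_zero_iff, norm_mul, Complex.norm_real, Real.norm_of_nonneg hε.le]
      exact (mul_le_mul_of_nonneg_left (hRΘ _ (hτΘ j)) hε.le).trans ((le_div_iff₀ hR).1 hε1))
    refine (hbest.2 s ⟨_, fun j => ⟨τ j, hτΘ j, by simp [Complex.real_smul]⟩, hs⟩).trans ?_
    refine uniformError_smul_le fun z hz => ?_
    obtain ⟨hd, he⟩ := herr ε hε hε0 τ (fun j => hRΘ _ (hτΘ j)) s hs z (hRK z hz)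
    refine ⟨hd, ?_⟩
    have h1 := norm_le_norm_add_norm_sub' (ratVal s (ε * z) - f (ε * z))
      (a * (ε : ℂ) ^ (m + n + 1) * ∏ j, (z - τ j))
    rw [hnorm hε] at h1
    have h2 : ‖a‖ * ε ^ (m + n + 1) * ∏ j, ‖z - τ j‖ ≤ ‖a‖ * ε ^ (m + n + 1) * t :=
      mul_le_mul_of_nonneg_left (prod_norm_sub_le_maxNodeProd hK τ hz) (by positivity)
    linarith
  have hconv : ∀ y : ℝ → Fin (m + n + 1) → ℂ,
      (∀ᶠ ε : ℝ in 𝓝[>] 0, (∀ j, y ε j ∈ Θ) ∧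
        IsNewtonPade E f m n (fun j => (ε : ℂ) * y ε j) (r ε)) →
      ∃ σ : ℝ → Equiv.Perm (Fin (m + n + 1)),
        Tendsto (fun ε => y ε ∘ σ ε) (𝓝[>] 0) (𝓝 τ) := by
    intro y hy
    refine hτ.exists_perm_tendsto hK hKinf (Nat.succ_pos _) hΘ (hy.mono fun _ h => h.1) ?_
    intro η hη
    -- One C comes from the upper bound on the best error, the other from the expansion at the nodes
    -- of `r ε`.
    have hlin : ∀ᶠ ε : ℝ in 𝓝[>] 0, 2 * C * ε < η * ‖a‖ := by
      have hc : ContinuousAt (fun ε : ℝ => 2 * C * ε) 0 := by fun_prop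
      refine (hc.tendsto.mono_left nhdsWithin_le_nhds).eventually_lt_const ?_
      simpa using mul_pos hη ha'
    filter_upwards [hsmall, hupper, hy, hlin] with ε ⟨hε, hε0, _⟩ hup ⟨hyΘ, hnp⟩ hl z hz
    obtain ⟨-, he⟩ := herr ε hε hε0 (y ε) (fun j => hRΘ _ (hyΘ j)) _ hnp z (hRK z hz)
    have ht0 : 0 ≤ t := (Finset.prod_nonneg fun _ _ => norm_nonneg _).trans
      (prod_norm_sub_le_maxNodeProd hK τ hz)
    have h1 := (ENNReal.ofReal_le_ofReal_iff (by positivity)).1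
      ((ofReal_le_uniformError_smul hz).trans hup)
    have h2 := norm_le_norm_add_norm_sub (ratVal (r ε) (ε * z) - f (ε * z))
      (a * (ε : ℂ) ^ (m + n + 1) * ∏ j, (z - y ε j))
    rw [hnorm hε] at h2
    have hpow : 0 < ε ^ (m + n + 1) := by positivity
    have h3 : ε ^ (m + n + 1) * (‖a‖ * ∏ j, ‖z - y ε j‖) ≤
        ε ^ (m + n + 1) * (‖a‖ * t + 2 * C * ε) := by
      have : C * ε ^ (m + n + 2) = ε ^ (m + n + 1) * (C * ε) := by ring
      linarith
    have h4 := le_of_mul_le_mul_left h3 hpow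
    refine le_of_mul_le_mul_left (h4.trans ?_) ha'
    linarith
  obtain ⟨y, hy⟩ : ∃ y : ℝ → Fin (m + n + 1) → ℂ, ∀ᶠ ε : ℝ in 𝓝[>] 0, (∀ j, y ε j ∈ Θ) ∧
      IsNewtonPade E f m n (fun j => (ε : ℂ) * y ε j) (r ε) := by
    have hex : ∀ᶠ ε : ℝ in 𝓝[>] 0, ∃ y : Fin (m + n + 1) → ℂ, (∀ j, y j ∈ Θ) ∧
        IsNewtonPade E f m n (fun j => (ε : ℂ) * y j) (r ε) := by
      filter_upwards [hsmall, hr] with ε ⟨hε, _⟩ ⟨⟨x, hx, hnp⟩, _⟩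
      refine ⟨fun j => x j / ε, fun j => (div_mem_of_mem_smul hε.ne' (hx j)).1, ?_⟩
      convert hnp using 2 with j
      exact (div_mem_of_mem_smul hε.ne' (hx j)).2
    exact hex.choice
  refine ⟨fun x hx => ?_, fun c hc => ?_, ?_, ?_⟩
  · obtain ⟨σ, hσ⟩ := hconv (fun ε j => x ε j / ε) (by
      filter_upwards [hsmall, hx] with ε ⟨hε, _⟩ ⟨hxΘ, hnp⟩
      refine ⟨fun j => (div_mem_of_mem_smul hε.ne' (hxΘ j)).1, ?_⟩
      convert hnp using 2 with j
      exact (div_mem_of_mem_smul hε.ne' (hxΘ j)).2)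
    exact ⟨σ, fun j => (tendsto_pi_nhds.1 hσ) j⟩
  · obtain ⟨σ, hσ⟩ := hconv y hy
    have hunif : ∀ᶠ w in 𝓝 τ, ∀ z ∈ K,
        ‖∏ j, (z - w j) - ∏ j, (z - τ j)‖ < c / (2 * ‖a‖) := by
      refine hK.eventually_forall_of_forall_eventually fun z _ => ?_
      have hcont : Continuous fun p : (Fin (m + n + 1) → ℂ) × ℂ =>
          ‖∏ j, (p.2 - p.1 j) - ∏ j, (p.2 - τ j)‖ := by fun_prop
      refine (hcont.tendsto (τ, z)).eventually_lt_const ?_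
      simp only [sub_self, norm_zero]
      positivity
    have hlin : ∀ᶠ ε : ℝ in 𝓝[>] 0, C * ε < c / 2 := by
      have hc' : ContinuousAt (fun ε : ℝ => C * ε) 0 := by fun_prop
      refine (hc'.tendsto.mono_left nhdsWithin_le_nhds).eventually_lt_const ?_
      simpa using hc
    filter_upwards [hsmall, hy, hσ.eventually hunif, hlin] with ε ⟨hε, hε0, _⟩ ⟨hyΘ, hnp⟩ hu hl z hz
    obtain ⟨hd, he⟩ := herr ε hε hε0 (y ε) (fun j => hRΘ _ (hyΘ j)) _ hnp z (hRK z hz)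
    refine ⟨hd, ?_⟩
    have h1 := hu z hz
    simp only [Function.comp_apply] at h1
    rw [Equiv.prod_comp (σ ε) fun j => z - y ε j] at h1
    have hpow : 0 < ε ^ (m + n + 1) := by positivity
    have h2 : ‖a * (ε : ℂ) ^ (m + n + 1) * ∏ j, (z - y ε j) -
        a * (ε : ℂ) ^ (m + n + 1) * ∏ j, (z - τ j)‖ ≤ c / 2 * ε ^ (m + n + 1) := by
      rw [← mul_sub, norm_mul, norm_mul, norm_pow, Complex.norm_real, Real.norm_of_nonneg hε.le]
      calc _ ≤ ‖a‖ * ε ^ (m + n + 1) * (c / (2 * ‖a‖)) := by gcongr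
        _ = _ := by field_simp
    have h3 : C * ε ^ (m + n + 2) ≤ c / 2 * ε ^ (m + n + 1) := by
      calc _ = C * ε * ε ^ (m + n + 1) := by ring
        _ ≤ _ := by gcongr
    refine (norm_sub_le_norm_sub_add_norm_sub _
      (a * (ε : ℂ) ^ (m + n + 1) * ∏ j, (z - y ε j)) _).trans ?_
    linarith
  · filter_upwards [hupper] with ε h
    exact (h.trans_lt ENNReal.ofReal_lt_top).ne
  · refine IsBigO.of_bound C ?_
    filter_upwards [hsmall, hupper, hy] with ε ⟨hε, hε0, _⟩ hup ⟨hyΘ, hnp⟩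
    -- Minimality applied directly to the actual node polynomial gives the lower bound, so the
    -- O(ε^(N+1)) remainder needs no rate for the convergence of the nodes.
    obtain ⟨z, hz, htz⟩ := hτ.exists_maxNodeProd_le hK hKne (Nat.succ_pos _)
      (monic_prod_X_sub_C_fin (y ε)) (natDegree_prod_X_sub_C_fin (y ε))
    rw [norm_eval_prod_X_sub_C] at htz
    have ht0 : 0 ≤ t := (Finset.prod_nonneg fun _ _ => norm_nonneg _).trans
      (prod_norm_sub_le_maxNodeProd hK τ hz)
    obtain ⟨-, he⟩ := herr ε hε hε0 (y ε) (fun j => hRΘ _ (hyΘ j)) _ hnp z (hRK z hz)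
    have h1 := ENNReal.toReal_le_of_le_ofReal (by positivity) hup
    have h2 := (ENNReal.ofReal_le_iff_le_toReal (hup.trans_lt ENNReal.ofReal_lt_top).ne).1
      (ofReal_le_uniformError_smul (f := f) (r := r ε) (ε := ε) hz)
    have h3 := norm_le_norm_add_norm_sub (ratVal (r ε) (ε * z) - f (ε * z))
      (a * (ε : ℂ) ^ (m + n + 1) * ∏ j, (z - y ε j))
    rw [hnorm hε] at h3
    have h4 : ‖a‖ * ε ^ (m + n + 1) * t ≤ ‖a‖ * ε ^ (m + n + 1) * ∏ j, ‖z - y ε j‖ :=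
      mul_le_mul_of_nonneg_left htz (by positivity)
    rw [Real.norm_eq_abs, Real.norm_of_nonneg (by positivity : (0 : ℝ) ≤ ε ^ (m + n + 2)), abs_le]
    constructor <;> linarith
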